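/- Let $\overline G=(V,A)$ be a finite directed graph without loops, with positive rational arc weights $w_{ij}$ ($(i,j)\in A$), and let $(V_1,V_2)$ be a partition of $V$ into two (possibly empty) sets. Let $G=(V,E)$ be the undirected graph in which $ij\in E$ if and only if both $(i,j)\in A$ and $(j,i)\in A$, with edge weights $w(ij)=w_{ij}+w_{ji}$. For a matching $M$ of $G$ let $w(M)=\sum_{e\in M}w(e)$, and for $p=1,2$ let $u_p(M)=\sum_{i,j:\,ij\in M,\ j\in V_p}w_{ij}$. These data define a directed partitioned matching game with player set $N=\{1,2\}$, in which the value $v(S)$ of a coalition $S\subseteq N$ is the maximum of $w(M)$ over all matchings $M$ of the subgraph of $G$ induced by $\bigcup_{p\in S}V_p$. The game is $3$-sparse if the arc weights take at most three distinct values. It is perfect if $w_{ij}=\frac13$ and $w_{ji}=\frac23$ for every edge $ij\in E$ with $i\in V_1$, $j\in V_2$, and $w_{ij}=w_{ji}=\frac12$ for every other edge $ij\in E$, and $G$ has a perfect matching. A target allocation is a vector $x=(x_1,x_2)$ of rational numbers with $x_1+x_2=v(N)$. A maximum-weight matching $M$ of $G$ is minimal for $x$ if it minimizes $\max_{p\in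 N}|x_p-u_p(M)|$ over all maximum-weight matchings of $G$. Consider the following two problems (numbers are encoded in binary). (1) Exact Perfect Matching: given a finite undirected graph, a partition of its edge set into a set $R$ of red edges and a set $B$ of blue edges, and an integer $k\ge 0$, decide whether the graph has a perfect matching with exactly $k$ red edges. (2) Given a $3$-sparse perfect directed partitioned matching game with two players and a target allocation $x$, find a minimal maximum-weight matching for $x$. Theorem. Problems (1) and (2) are polynomially equivalent, that is, each of them is polynomial-time Turing reducible to the other. (The reduction has to work for every oracle that answers the instances of the other problem correctly and has answers of polynomially bounded length; on strings that do not encode an instance, the answers of the oracle are arbitrary.) -/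

import Mathlib

/-! ### Machine model: programs on binary trees, with an oracle and a step count -/

/-- The data handled by programs: finite binary trees without labels. -/
abbrev DTree : Type := BinaryTree Unit

namespace DTree

/-- The tree with the two given subtrees. -/
abbrev cons (a b : DTree) : DTree := BinaryTree.node () a b

/-- Left subtree (`nil` for the empty tree). -/
def hd : DTree → DTree
  | .nil => .nil
  | .node _ a _ => a

/-- Right subtree (`nil` for the empty tree). -/
def tl : DTree → DTree
  | .nil => .nil
  | .node _ _ b => b

end DTree

/-- Oracle programs. They form a WHILE language over binary trees: the whole store is one tree,
and the programs are closed under the tree operations, composition, case distinction, unbounded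
iteration, and calls of an oracle. -/
inductive Prog : Type
  | id : Prog
  | nil : Prog
  | hd : Prog
  | tl : Prog
  | query : Prog
  | cons : Prog → Prog → Prog
  | seq : Prog → Prog → Prog
  | cond : Prog → Prog → Prog → Prog
  | loop : Prog → Prog → Prog

/-- `Run O P x y t`: with the oracle `O`, the program `P` started on `x` halts with result `y`
after `t` steps.

* `cons P Q` returns the tree with subtrees `P(x)` and `Q(x)`;
* `seq P Q` returns `Q(P(x))`;
* `cond B P Q` returns `P(x)` if `B(x)` is not `nil`, and `Q(x)` if it is;
* `loop B P` replaces `x` by `P(x)` as long as `B(x)` is not `nil`;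
* `query` returns the answer `O x` of the oracle.

Each instruction is charged one step plus the number of nodes of the tree on which it acts, and a
query is also charged the number of nodes of the answer. In particular every tree produced by a
run has at most as many nodes as the run has steps, and such runs and those of multitape (oracle)
Turing machines simulate each other with polynomial overhead. -/
inductive Run (O : DTree → DTree) : Prog → DTree → DTree → ℕ → Prop
  | id (x : DTree) : Run O .id x x (1 + x.numNodes)
  | nil (x : DTree) : Run O .nil x .nil (1 + x.numNodes)
  | hd (x : DTree) : Run O .hd x x.hd (1 + x.numNodes)
  | tl (x : DTree) : Run O .tl x x.tl (1 + x.numNodes)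
  | query (x : DTree) : Run O .query x (O x) (1 + x.numNodes + (O x).numNodes)
  | cons {P Q : Prog} {x a b : DTree} {s t : ℕ} :
      Run O P x a s → Run O Q x b t →
      Run O (.cons P Q) x (DTree.cons a b) (1 + x.numNodes + s + t)
  | seq {P Q : Prog} {x y z : DTree} {s t : ℕ} :
      Run O P x y s → Run O Q y z t → Run O (.seq P Q) x z (1 + x.numNodes + s + t)
  | cond_true {B P Q : Prog} {x b y : DTree} {s t : ℕ} :
      Run O B x b s → b ≠ .nil → Run O P x y t →
      Run O (.cond B P Q) x y (1 + x.numNodes + s + t)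
  | cond_false {B P Q : Prog} {x y : DTree} {s t : ℕ} :
      Run O B x .nil s → Run O Q x y t →
      Run O (.cond B P Q) x y (1 + x.numNodes + s + t)
  | loop_stop {B P : Prog} {x : DTree} {s : ℕ} :
      Run O B x .nil s → Run O (.loop B P) x x (1 + x.numNodes + s)
  | loop_step {B P : Prog} {x b y z : DTree} {s t u : ℕ} :
      Run O B x b s → b ≠ .nil → Run O P x y t → Run O (.loop B P) y z u →
      Run O (.loop B P) x z (1 + x.numNodes + s + t + u)

/-! ### Computational problems and polynomial equivalence -/

/-- A computational problem: a type of (promised) instances, an unambiguous encoding of them as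
trees, and the answers that are correct for an instance. Search problems may have several correct
answers. A decision problem has the truth value as its only correct answer. -/
structure CompProblem where
  Inst : Type
  enc : Inst → DTree
  enc_injective : Function.Injective enc
  Correct : Inst → DTree → Prop

/-- `O` answers every instance of `A` correctly. On trees that do not encode an instance of `A`,
nothing is required. -/
def CompProblem.SolvedBy (A : CompProblem) (O : DTree → DTree) : Prop :=
  ∀ I : A.Inst, A.Correct I (O (A.enc I))

/-- Polynomial-time Turing reducibility of `A` to `B`: one oracle program solves `A`, whatever
oracle for `B` it is given, in a number of steps that is polynomial in the size of the
instance. Oracles have answers of polynomially bounded length (`q`), and the time bound `p` depends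
on that bound but not on the oracle. -/
def PolyReducible (A B : CompProblem) : Prop :=
  ∃ P : Prog, ∀ q : Polynomial ℕ, ∃ p : Polynomial ℕ, ∀ O : DTree → DTree,
    B.SolvedBy O → (∀ y, (O y).numNodes ≤ q.eval y.numNodes) →
    ∀ I : A.Inst, ∃ (y : DTree) (t : ℕ),
      Run O P (A.enc I) y t ∧ A.Correct I y ∧ t ≤ p.eval (A.enc I).numNodes

/-- Two problems are polynomially equivalent if each is polynomial-time Turing reducible to the
other. -/
def PolyEquivalent (A B : CompProblem) : Prop :=
  PolyReducible A B ∧ PolyReducible B A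

/-! ### Encodings (numbers in binary, graphs by adjacency matrices) -/

namespace Enc

/-- Truth values. -/
def bool (b : Bool) : DTree := if b then DTree.cons .nil .nil else .nil

open Classical in
/-- The truth value of a proposition. -/
noncomputable def prop (p : Prop) : DTree := bool (decide p)

/-- Lists. -/
def list : List DTree → DTree
  | [] => .nil
  | a :: l => DTree.cons a (list l)

/-- Natural numbers in binary, least significant bit first. -/
def nat (n : ℕ) : DTree := list (n.bits.map bool)

/-- Integers: sign and absolute value. -/
def int (z : ℤ) : DTree := DTree.cons (bool (decide (z < 0))) (nat z.natAbs)

/-- Rational numbers: reduced fractions. -/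
def rat (r : ℚ) : DTree := DTree.cons (int r.num) (nat r.den)

/-- Vectors. -/
def vector {n : ℕ} (f : Fin n → DTree) : DTree := list (List.ofFn f)

/-- Square matrices, as the list of the rows. -/
def matrix {n : ℕ} (f : Fin n → Fin n → DTree) : DTree := vector fun i => vector (f i)

theorem bool_injective : Function.Injective bool := by
  intro a b h
  cases a <;> cases b <;> simp_all [bool]

theorem prop_eq {p q : Prop} (h : prop p = prop q) : p ↔ q := by
  classical
  have h' := bool_injective h
  simpa using h'

theorem list_injective : Function.Injective list := by
  intro l
  induction l with
  | nil => intro m h; cases m <;> simp_all [list]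
  | cons a l ih =>
    intro m h
    cases m with
    | nil => simp [list] at h
    | cons b m =>
      simp only [list, BinaryTree.node.injEq, true_and] at h
      rw [h.1, ih h.2]

theorem bits_injective : Function.Injective Nat.bits := by
  have key : ∀ n : ℕ, n.bits.foldr Nat.bit 0 = n := by
    intro n
    induction n using Nat.binaryRec' with
    | zero => simp
    | bit b n hn ih => rw [Nat.bits_append_bit n b hn, List.foldr_cons, ih]
  exact Function.LeftInverse.injective (g := fun l : List Bool => l.foldr Nat.bit 0) key

theorem nat_injective : Function.Injective nat := fun _ _ h =>
  bits_injective (List.map_injective_iff.2 bool_injective (list_injective h))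

theorem int_injective : Function.Injective int := by
  intro a b h
  simp only [int, BinaryTree.node.injEq, true_and] at h
  have h1 := bool_injective h.1
  have h2 := nat_injective h.2
  rw [decide_eq_decide] at h1
  omega

theorem rat_injective : Function.Injective rat := by
  intro a b h
  simp only [rat, BinaryTree.node.injEq, true_and] at h
  exact Rat.ext (int_injective h.1) (nat_injective h.2)

theorem vector_injective {n : ℕ} : Function.Injective (vector (n := n)) := fun _ _ h =>
  List.ofFn_injective (list_injective h)

theorem matrix_injective {n : ℕ} : Function.Injective (matrix (n := n)) := by
  intro f g h
  have h' := vector_injective h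
  funext i
  exact vector_injective (congrFun h' i)

theorem vector_length {n m : ℕ} {f : Fin n → DTree} {g : Fin m → DTree}
    (h : vector f = vector g) : n = m := by
  have := congrArg List.length (list_injective h)
  simpa using this

end Enc

/-! ### Exact Perfect Matching -/

/-- An instance of Exact Perfect Matching: a finite undirected graph (on the vertices
`0, …, n - 1`), a partition of its edge set into red and blue edges, and a number `k`. -/
@[ext] structure EPMInstance where
  n : ℕ
  graph : SimpleGraph (Fin n)
  red : Set (Sym2 (Fin n))
  blue : Set (Sym2 (Fin n))
  union_eq : red ∪ blue = graph.edgeSet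
  disj : Disjoint red blue
  k : ℕ

/-- There is a perfect matching with exactly `k` red edges. -/
def EPMInstance.IsYes (I : EPMInstance) : Prop :=
  ∃ M : I.graph.Subgraph, M.IsPerfectMatching ∧ (M.edgeSet ∩ I.red).ncard = I.k

/-- The encoding of an instance: the adjacency matrices of the red and of the blue edges,
and `k` in binary. -/
noncomputable def EPMInstance.enc (I : EPMInstance) : DTree :=
  DTree.cons (Enc.matrix fun i j => Enc.prop (s(i, j) ∈ I.red))
    (DTree.cons (Enc.matrix fun i j => Enc.prop (s(i, j) ∈ I.blue)) (Enc.nat I.k))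

theorem EPMInstance.enc_injective : Function.Injective EPMInstance.enc := by
  rintro ⟨n, G, R, B, hu, hd, k⟩ ⟨n', G', R', B', hu', hd', k'⟩ h
  simp only [EPMInstance.enc, BinaryTree.node.injEq, true_and] at h
  obtain ⟨h1, h2, h3⟩ := h
  obtain rfl : n = n' := Enc.vector_length h1
  have h1' := Enc.matrix_injective h1
  have h2' := Enc.matrix_injective h2
  obtain rfl : R = R' := by
    ext e
    induction e with
    | _ i j => exact Enc.prop_eq (congrFun (congrFun h1' i) j)
  obtain rfl : B = B' := by
    ext e
    induction e with
    | _ i j => exact Enc.prop_eq (congrFun (congrFun h2' i) j)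
  obtain rfl : G = G' := SimpleGraph.edgeSet_injective (hu.symm.trans hu')
  obtain rfl : k = k' := Enc.nat_injective h3
  rfl

/-- The decision problem Exact Perfect Matching. -/
noncomputable def ExactPerfectMatching : CompProblem where
  Inst := EPMInstance
  enc := EPMInstance.enc
  enc_injective := EPMInstance.enc_injective
  Correct I y := y = Enc.prop I.IsYes

/-! ### Directed partitioned matching games -/

/-- The data of a directed partitioned matching game with vertex set `V` and player set `ι`: a
directed compatibility graph without loops, a positive arc weighting (extended by zero to pairs that
are not arcs), and a partition `(V_p)` of `V`, where `V_p` is the set of `i` with `part i = p`. -/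
@[ext] structure DirPMGame (V ι : Type) where
  arcs : Digraph V
  loopless : ∀ i, ¬ arcs.Adj i i
  w : V → V → ℚ
  w_pos : ∀ i j, arcs.Adj i j → 0 < w i j
  w_zero : ∀ i j, ¬ arcs.Adj i j → w i j = 0
  part : V → ι

namespace DirPMGame

variable {V ι : Type}

/-- The undirected compatibility graph: `ij` is an edge if both `(i,j)` and `(j,i)` are arcs. -/
def graph (Γ : DirPMGame V ι) : SimpleGraph V where
  Adj i j := Γ.arcs.Adj i j ∧ Γ.arcs.Adj j i
  symm := ⟨fun _ _ h => ⟨h.2, h.1⟩⟩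
  loopless := ⟨fun i h => Γ.loopless i h.1⟩

/-- The weight of an edge `ij` is `w_ij + w_ji`. -/
def edgeWeight (Γ : DirPMGame V ι) : Sym2 V → ℚ :=
  Sym2.lift ⟨fun i j => Γ.w i j + Γ.w j i, fun _ _ => add_comm _ _⟩

open Classical in
/-- The weight `w(M)` of a matching `M`, the total weight of its edges. -/
noncomputable def weight [Fintype V] (Γ : DirPMGame V ι) (M : Γ.graph.Subgraph) : ℚ :=
  ∑ e : Sym2 V with e ∈ M.edgeSet, Γ.edgeWeight e

open Classical in
/-- The share `u_p(M)` of player `p`: the sum of `w_ij` over all `i, j` with `ij ∈ M`,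
`j ∈ V_p`. -/
noncomputable def utility [Fintype V] (Γ : DirPMGame V ι) (M : Γ.graph.Subgraph) (p : ι) : ℚ :=
  ∑ i : V, ∑ j : V, if M.Adj i j ∧ Γ.part j = p then Γ.w i j else 0

/-- The set of matchings of the subgraph induced by the vertices of the players in `S`. -/
noncomputable def coalitionMatchings [Finite V] (Γ : DirPMGame V ι) (S : Set ι) :
    Finset Γ.graph.Subgraph :=
  (Set.toFinite {M : Γ.graph.Subgraph | M.IsMatching ∧ ∀ i ∈ M.verts, Γ.part i ∈ S}).toFinset

theorem coalitionMatchings_nonempty [Finite V] (Γ : DirPMGame V ι) (S : Set ι) :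
    (Γ.coalitionMatchings S).Nonempty :=
  ⟨⊥, by simp [coalitionMatchings, SimpleGraph.Subgraph.IsMatching]⟩

/-- The value `v(S)` of a coalition: the maximum weight of a matching of the subgraph induced by
the vertices of the players in `S`. -/
noncomputable def value [Fintype V] (Γ : DirPMGame V ι) (S : Set ι) : ℚ :=
  (Γ.coalitionMatchings S).sup' (Γ.coalitionMatchings_nonempty S) Γ.weight

/-- `x` is an allocation: `x(N) = v(N)`. -/
def IsAllocation [Fintype V] [Fintype ι] (Γ : DirPMGame V ι) (x : ι → ℚ) : Prop :=
  ∑ p, x p = Γ.value Set.univ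

/-- Maximum weight matchings of the compatibility graph. -/
def IsMaxWeightMatching [Fintype V] (Γ : DirPMGame V ι) (M : Γ.graph.Subgraph) : Prop :=
  M.IsMatching ∧ ∀ M' : Γ.graph.Subgraph, M'.IsMatching → Γ.weight M' ≤ Γ.weight M

/-- The largest deviation `|x_p - u_p(M)|` of a player `p` from its target. -/
noncomputable def maxDeviation [Fintype V] [Fintype ι] [Nonempty ι] (Γ : DirPMGame V ι) (x : ι → ℚ)
    (M : Γ.graph.Subgraph) : ℚ :=
  Finset.univ.sup' Finset.univ_nonempty fun p => |x p - Γ.utility M p|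

/-- Minimal maximum weight matchings for the target `x`: they minimize the largest deviation among
all maximum weight matchings. -/
def IsMinimalMatching [Fintype V] [Fintype ι] [Nonempty ι] (Γ : DirPMGame V ι) (x : ι → ℚ)
    (M : Γ.graph.Subgraph) : Prop :=
  Γ.IsMaxWeightMatching M ∧
    ∀ M' : Γ.graph.Subgraph, Γ.IsMaxWeightMatching M' → Γ.maxDeviation x M ≤ Γ.maxDeviation x M'

/-- The arc weighting takes at most `d` distinct values. -/
def IsSparse (Γ : DirPMGame V ι) (d : ℕ) : Prop :=
  {r : ℚ | ∃ i j, Γ.arcs.Adj i j ∧ Γ.w i j = r}.encard ≤ d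

/-- Perfect games with two players `0` and `1`: for every edge `ij` of the compatibility graph with
`i ∈ V_0` and `j ∈ V_1` the weights are `w_ij = 1/3` and `w_ji = 2/3`, for the other edges
they are `1/2`, and the compatibility graph has a perfect matching. -/
def IsPerfect (Γ : DirPMGame V (Fin 2)) : Prop :=
  (∀ i j, Γ.graph.Adj i j → Γ.part i = 0 → Γ.part j = 1 → Γ.w i j = 1 / 3 ∧ Γ.w j i = 2 / 3) ∧
  (∀ i j, Γ.graph.Adj i j → Γ.part i = Γ.part j → Γ.w i j = 1 / 2) ∧
  ∃ M : Γ.graph.Subgraph, M.IsPerfectMatching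

end DirPMGame

/-- An instance of the matching problem: a `3`-sparse perfect directed partitioned matching game
(on the vertices `0, …, n - 1`, with two players) and a target allocation. -/
structure PerfectGameInstance where
  n : ℕ
  game : DirPMGame (Fin n) (Fin 2)
  sparse : game.IsSparse 3
  perfect : game.IsPerfect
  x : Fin 2 → ℚ
  alloc : game.IsAllocation x

/-- The encoding of an instance: the matrix of the arc weights (`0` if there is no arc), the vector
that tells for each vertex whether it belongs to player `1`, and the target. -/
def PerfectGameInstance.enc (I : PerfectGameInstance) : DTree :=
  DTree.cons (Enc.matrix fun i j => Enc.rat (I.game.w i j))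
    (DTree.cons (Enc.vector fun i => Enc.bool (decide (I.game.part i = 1)))
      (DTree.cons (Enc.rat (I.x 0)) (Enc.rat (I.x 1))))

theorem PerfectGameInstance.enc_injective : Function.Injective PerfectGameInstance.enc := by
  rintro ⟨n, Γ, hs, hp, x, hx⟩ ⟨n', Γ', hs', hp', x', hx'⟩ h
  simp only [PerfectGameInstance.enc, BinaryTree.node.injEq, true_and] at h
  obtain ⟨h1, h2, h3, h4⟩ := h
  obtain rfl : n = n' := Enc.vector_length h1
  have h1' := Enc.matrix_injective h1
  have h2' := Enc.vector_injective h2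
  have hw : Γ.w = Γ'.w := by
    funext i j
    exact Enc.rat_injective (congrFun (congrFun h1' i) j)
  have hadj : ∀ (Δ : DirPMGame (Fin n) (Fin 2)) (i j), Δ.arcs.Adj i j ↔ 0 < Δ.w i j := by
    intro Δ i j
    refine ⟨Δ.w_pos i j, fun h => ?_⟩
    by_contra hc
    rw [Δ.w_zero i j hc] at h
    exact lt_irrefl _ h
  have ha : Γ.arcs = Γ'.arcs := by
    ext i j
    rw [hadj, hadj, hw]
  have hpart : Γ.part = Γ'.part := by
    funext i
    have hi := Enc.bool_injective (congrFun h2' i)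
    rw [decide_eq_decide] at hi
    omega
  obtain rfl : Γ = Γ' := DirPMGame.ext ha hw hpart
  obtain rfl : x = x' := by
    funext p
    match p with
    | 0 => exact Enc.rat_injective h3
    | 1 => exact Enc.rat_injective h4
  rfl

/-- The search problem: given a `3`-sparse perfect directed partitioned matching game with two
players and a target allocation, find (the adjacency matrix of) a minimal maximum weight
matching. -/
noncomputable def MinimalMatchingPerfectGame : CompProblem where
  Inst := PerfectGameInstance
  enc := PerfectGameInstance.enc
  enc_injective := PerfectGameInstance.enc_injective
  Correct I y := ∃ M : I.game.graph.Subgraph, I.game.IsMinimalMatching I.x M ∧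
    y = Enc.matrix fun i j => Enc.prop (M.Adj i j)

/-! ### Polynomial-time computable functions on encoded data -/

/-! In a perfect game every edge of the compatibility graph has weight 1. Since there is a perfect
matching, the maximum-weight matchings are exactly the perfect ones. In a perfect matching each
vertex of player `0` contributes `1/2` to that player's share, and each crossing edge adds `1/6`.
The shares sum to `v(N)`, so the two deviations have equal absolute value. Minimality for a target
therefore means that the number of crossing edges is as close as possible to a prescribed rational
(`IsPerfect.utility_zero`, `IsPerfect.maxDeviation_eq`, `IsPerfect.isMinimalMatching_iff`).

From games to Exact Perfect Matching: colour the crossing edges red and ask, for every `c` up to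
`n`, whether some perfect matching has `c` red edges. The best achievable `c` is picked
(`bestNumber_spec`). Then edges are deleted greedily while a perfect matching with `c` crossing
edges survives; what is left is such a matching (`List.foldl_greedy`, `solveGame_correct`).

From Exact Perfect Matching to games: each edge `ij` is subdivided into the path `(i,i)`, `(i,j)`,
`(j,i)`, `(j,j)`, and player `1` owns the inner vertices of red edges. Perfect matchings of the
gadget correspond to those of the original graph (`exists_eq_gadgetPartner`), and a red matching
edge becomes two crossing edges (`cross_gadgetGame`). A target near the share for `k` red edges
makes the oracle return a matching with `k` red edges if one exists (`verify_of_isYes`). Without a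
perfect matching in the original graph the query is not an instance and its answer is arbitrary, so
every answer is verified (`isYes_of_verify`).

The running times come from the class `PolyTime`. It is closed under composition, case distinction
and folds over lists with polynomially bounded states, so instance search assembles most of the
program for each algorithm from its definition. Counters are unary; only the input numbers are
binary. -/

theorem Polynomial.eval_le_eval_of_le (p : Polynomial ℕ) {m n : ℕ} (h : m ≤ n) :
    p.eval m ≤ p.eval n := by
  rw [Polynomial.eval_eq_sum_range, Polynomial.eval_eq_sum_range]
  gcongr

/-- The result of a run has at most as many nodes as the run has steps. -/
theorem Run.numNodes_le {O : DTree → DTree} {P : Prog} {x y : DTree} {t : ℕ} (h : Run O P x y t) :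
    y.numNodes ≤ t := by
  induction h with
  | id x => omega
  | nil x => simp
  | hd x => cases x <;> simp [DTree.hd]; omega
  | tl x => cases x <;> simp [DTree.tl]; omega
  | query x => omega
  | cons _ _ h1 h2 => simp; omega
  | seq _ _ h1 h2 => omega
  | cond_true => omega
  | cond_false => omega
  | loop_stop => omega
  | loop_step => omega

/-- Types whose elements are encoded as trees. -/
class TreeCode (α : Type) where
  code : α → DTree

open TreeCode (code)

instance : TreeCode DTree := ⟨fun x => x⟩

instance : TreeCode Bool := ⟨Enc.bool⟩

instance : TreeCode Unit := ⟨fun _ => .nil⟩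

instance {α β : Type} [TreeCode α] [TreeCode β] : TreeCode (α × β) :=
  ⟨fun p => DTree.cons (code p.1) (code p.2)⟩

instance {α : Type} [TreeCode α] : TreeCode (List α) := ⟨fun l => Enc.list (l.map code)⟩

/-- Natural numbers are encoded in unary. -/
instance : TreeCode ℕ := ⟨fun n => Enc.list (List.replicate n .nil)⟩

/-- The number of nodes of the encoding. -/
def codeSize {α : Type} [TreeCode α] (a : α) : ℕ := (code a).numNodes

/-! ### Sizes of encodings -/

section CodeSize

variable {α β : Type} [TreeCode α] [TreeCode β]

theorem codeSize_prod (p : α × β) : codeSize p = codeSize p.1 + codeSize p.2 + 1 := by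
  simp [codeSize, code, DTree.cons]

theorem codeSize_nil : codeSize ([] : List α) = 0 := by simp [codeSize, code, Enc.list]

theorem codeSize_cons (a : α) (l : List α) : codeSize (a :: l) = codeSize a + codeSize l + 1 := by
  simp [codeSize, code, Enc.list, DTree.cons]

theorem codeSize_append (l m : List α) : codeSize (l ++ m) = codeSize l + codeSize m := by
  induction l with
  | nil => simp [codeSize_nil]
  | cons a l ih => simp [codeSize_cons, ih]; omega

theorem codeSize_nat (n : ℕ) : codeSize n = n := by
  induction n with
  | zero => simp [codeSize, code, Enc.list]
  | succ n ih =>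
    simp only [codeSize, code] at ih
    simp [codeSize, code, List.replicate_succ, Enc.list, DTree.cons, ih]

theorem codeSize_bool_le (b : Bool) : codeSize b ≤ 1 := by
  cases b <;> simp [codeSize, code, Enc.bool, DTree.cons]

theorem length_le_codeSize (l : List α) : l.length ≤ codeSize l := by
  induction l with
  | nil => simp
  | cons a l ih => simp [codeSize_cons]; omega

end CodeSize

/-- Functions with an oracle that are computed by one program in polynomial time, for all oracles
with answers of polynomially bounded length. -/
class PolyTime {α β : Type} [TreeCode α] [TreeCode β] (F : (DTree → DTree) → α → β) : Prop where
  out : ∃ P : Prog, ∀ q : Polynomial ℕ, ∃ p : Polynomial ℕ, ∀ O : DTree → DTree,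
    (∀ y, (O y).numNodes ≤ q.eval y.numNodes) →
    ∀ a : α, ∃ t, Run O P (code a) (code (F O a)) t ∧ t ≤ p.eval (codeSize a)

/-! ### Closure of `PolyTime` under composition, pairing, case distinction and iteration -/

namespace PolyTime

variable {α β γ σ : Type} [TreeCode α] [TreeCode β] [TreeCode γ] [TreeCode σ]

open Polynomial in
instance id : PolyTime fun _ (a : α) => a :=
  ⟨.id, fun _ => ⟨1 + X, fun _ _ _ => ⟨_, .id _, by simp [codeSize]⟩⟩⟩

/-- Programs see only codes, so functions with equal codes share a program. This gives conversions
at no cost: a pair read as a list cell, a list of units as a unary number, any value as its tree. -/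
theorem of_code_eq {F : (DTree → DTree) → α → β} {G : (DTree → DTree) → α → γ}
    (hF : PolyTime F) (h : ∀ O a, code (G O a) = code (F O a)) : PolyTime G := by
  obtain ⟨P, hP⟩ := hF
  exact ⟨P, fun q => by simpa only [h] using hP q⟩

/-- The output of a polynomial-time function has polynomial size. -/
theorem codeSize_le {F : (DTree → DTree) → α → β} (hF : PolyTime F) (q : Polynomial ℕ) :
    ∃ p : Polynomial ℕ, ∀ O : DTree → DTree, (∀ y, (O y).numNodes ≤ q.eval y.numNodes) →
      ∀ a, codeSize (F O a) ≤ p.eval (codeSize a) := by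
  obtain ⟨P, hP⟩ := hF
  obtain ⟨p, hp⟩ := hP q
  refine ⟨p, fun O hO a => ?_⟩
  obtain ⟨t, h1, h2⟩ := hp O hO a
  exact h1.numNodes_le.trans h2

open Polynomial in
-- The intermediate result is no larger than the running time of the first program, so the second
-- time bound is evaluated at the first one; polynomials are closed under this substitution.
theorem comp {G : (DTree → DTree) → β → γ} {F : (DTree → DTree) → α → β}
    (hG : PolyTime G) (hF : PolyTime F) : PolyTime fun O a => G O (F O a) := by
  obtain ⟨P, hP⟩ := hF
  obtain ⟨Q, hQ⟩ := hG
  refine ⟨.seq P Q, fun q => ?_⟩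
  obtain ⟨p₁, h₁⟩ := hP q
  obtain ⟨p₂, h₂⟩ := hQ q
  refine ⟨1 + X + p₁ + p₂.comp p₁, fun O hO a => ?_⟩
  obtain ⟨s, hs, hs'⟩ := h₁ O hO a
  obtain ⟨t, ht, ht'⟩ := h₂ O hO (F O a)
  refine ⟨_, .seq hs ht, ?_⟩
  have := p₂.eval_le_eval_of_le (hs.numNodes_le.trans hs')
  simp only [codeSize, eval_add, eval_one, eval_X, eval_comp] at *
  omega

open Polynomial in
instance (priority := 50) pair {F : (DTree → DTree) → α → β} {G : (DTree → DTree) → α → γ}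
    [hF : PolyTime F] [hG : PolyTime G] : PolyTime fun O a => (F O a, G O a) := by
  obtain ⟨P, hP⟩ := hF
  obtain ⟨Q, hQ⟩ := hG
  refine ⟨.cons P Q, fun q => ?_⟩
  obtain ⟨p₁, h₁⟩ := hP q
  obtain ⟨p₂, h₂⟩ := hQ q
  refine ⟨1 + X + p₁ + p₂, fun O hO a => ?_⟩
  obtain ⟨s, hs, hs'⟩ := h₁ O hO a
  obtain ⟨t, ht, ht'⟩ := h₂ O hO a
  refine ⟨_, .cons hs ht, ?_⟩
  simp only [codeSize, eval_add, eval_one, eval_X] at *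
  omega

theorem exists_const (c : DTree) : ∃ P : Prog, ∃ p : Polynomial ℕ, ∀ O x, ∃ t,
    Run O P x c t ∧ t ≤ p.eval x.numNodes := by
  induction c with
  | nil => exact ⟨.nil, 1 + .X, fun O x => ⟨_, .nil x, by simp⟩⟩
  | node u a b ha hb =>
    obtain ⟨P, p, hp⟩ := ha
    obtain ⟨Q, p', hp'⟩ := hb
    refine ⟨.cons P Q, 1 + .X + p + p', fun O x => ?_⟩
    obtain ⟨s, hs, hs'⟩ := hp O x
    obtain ⟨t, ht, ht'⟩ := hp' O x
    refine ⟨_, .cons hs ht, ?_⟩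
    simp
    omega

/-- Tried first, so that a constant of any encoded type is written out node by node by one program.
-/
instance (priority := 2000) const (c : β) : PolyTime fun _ (_ : α) => c := by
  obtain ⟨P, p, h⟩ := exists_const (code c)
  exact ⟨P, fun _ => ⟨p, fun O _ a => h O _⟩⟩

open Polynomial in
instance fst {F : (DTree → DTree) → α → β × γ} [hF : PolyTime F] :
    PolyTime fun O a => (F O a).1 :=
  comp (G := fun _ (p : β × γ) => p.1)
    ⟨.hd, fun _ => ⟨1 + X, fun _ _ _ => ⟨_, .hd _, by simp [codeSize]⟩⟩⟩ hF

open Polynomial in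
instance snd {F : (DTree → DTree) → α → β × γ} [hF : PolyTime F] :
    PolyTime fun O a => (F O a).2 :=
  comp (G := fun _ (p : β × γ) => p.2)
    ⟨.tl, fun _ => ⟨1 + X, fun _ _ _ => ⟨_, .tl _, by simp [codeSize]⟩⟩⟩ hF

open Polynomial in
instance query {F : (DTree → DTree) → α → DTree} [hF : PolyTime F] :
    PolyTime fun O a => O (F O a) :=
  comp (G := fun O (x : DTree) => O x)
    ⟨.query, fun q => ⟨1 + X + q, fun O hO a => ⟨_, .query _, by
      have := hO a
      simp only [codeSize, code, eval_add, eval_one, eval_X] at *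
      omega⟩⟩⟩ hF

open Polynomial in
/-- Case distinction by the test whether the encoding of `T` is empty. -/
theorem cases_code {T : (DTree → DTree) → α → σ} {F G H : (DTree → DTree) → α → β}
    (hT : PolyTime T) (hG : PolyTime G) (hH : PolyTime H)
    (h₁ : ∀ O a, code (T O a) = .nil → F O a = G O a)
    (h₂ : ∀ O a, code (T O a) ≠ .nil → F O a = H O a) : PolyTime F := by
  obtain ⟨B, hB⟩ := hT
  obtain ⟨P, hP⟩ := hG
  obtain ⟨Q, hQ⟩ := hH
  refine ⟨.cond B Q P, fun q => ?_⟩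
  obtain ⟨p₀, k₀⟩ := hB q
  obtain ⟨p₁, k₁⟩ := hP q
  obtain ⟨p₂, k₂⟩ := hQ q
  refine ⟨1 + X + p₀ + p₁ + p₂, fun O hO a => ?_⟩
  obtain ⟨r, hr, hr'⟩ := k₀ O hO a
  obtain ⟨s, hs, hs'⟩ := k₁ O hO a
  obtain ⟨t, ht, ht'⟩ := k₂ O hO a
  by_cases h : code (T O a) = .nil
  · rw [h] at hr
    rw [h₁ O a h]
    refine ⟨_, .cond_false hr hs, ?_⟩
    simp only [codeSize, eval_add, eval_one, eval_X] at *
    omega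
  · rw [h₂ O a h]
    refine ⟨_, .cond_true hr h ht, ?_⟩
    simp only [codeSize, eval_add, eval_one, eval_X] at *
    omega

open Polynomial in
/-- Case distinction by the form of a list. -/
theorem cases_list {l : (DTree → DTree) → α → List σ} {F G : (DTree → DTree) → α → β}
    {H : (DTree → DTree) → α × σ × List σ → β}
    (hl : PolyTime l) (hG : PolyTime G) (hH : PolyTime H)
    (h₁ : ∀ O a, l O a = [] → F O a = G O a)
    (h₂ : ∀ O a b t, l O a = b :: t → F O a = H O (a, b, t)) : PolyTime F := by
  obtain ⟨L, hL⟩ := hl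
  obtain ⟨P, hP⟩ := hG
  obtain ⟨Q, hQ⟩ := hH
  refine ⟨.cond L (.seq (.cons .id L) Q) P, fun q => ?_⟩
  obtain ⟨p₀, k₀⟩ := hL q
  obtain ⟨p₁, k₁⟩ := hP q
  obtain ⟨p₂, k₂⟩ := hQ q
  -- The list is computed twice, once as the test and once to be paired with the input, whence `2 *
  -- p₀`. The pair has size at most `X + p₀ + 1`.
  refine ⟨4 + 4 * X + 2 * p₀ + p₁ + p₂.comp (X + p₀ + 1), fun O hO a => ?_⟩
  obtain ⟨r, hr, hr'⟩ := k₀ O hO a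
  cases hla : l O a with
  | nil =>
    obtain ⟨s, hs, hs'⟩ := k₁ O hO a
    rw [hla] at hr
    rw [h₁ O a hla]
    refine ⟨_, .cond_false hr hs, ?_⟩
    simp only [codeSize, eval_add, eval_mul, eval_X, eval_ofNat] at *
    omega
  | cons b t =>
    obtain ⟨s, hs, hs'⟩ := k₂ O hO (a, b, t)
    have he : code (a, b, t) = DTree.cons (code a) (code (l O a)) := by
      rw [hla]; rfl
    have hn : code (l O a) ≠ .nil := by rw [hla]; simp [code, Enc.list]
    have hsz : codeSize (a, b, t) ≤ codeSize a + p₀.eval (codeSize a) + 1 := by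
      have := hr.numNodes_le
      simp only [codeSize, he, DTree.cons, BinaryTree.numNodes] at *
      omega
    have := p₂.eval_le_eval_of_le hsz
    rw [he] at hs
    rw [h₂ O a b t hla]
    refine ⟨_, .cond_true hr hn (.seq (.cons (.id _) hr) hs), ?_⟩
    simp only [codeSize, eval_add, eval_mul, eval_one, eval_X, eval_ofNat, eval_comp] at *
    omega

/-- Uniform bounds `T` on the costs of test and body and `S` on the states make each round cost at
most `1 + S + T + T`. There are `n` rounds and one last failing test. Induction on `n` peels off the
first round and shifts the iterates by one. -/
theorem exists_run_loop {O : DTree → DTree} {B P : Prog} {body : σ → σ} {test : σ → Bool}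
    {T S n : ℕ} {s : σ}
    (hB : ∀ i ≤ n, ∃ t, Run O B (code (body^[i] s)) (code (test (body^[i] s))) t ∧ t ≤ T)
    (hP : ∀ i ≤ n, ∃ t, Run O P (code (body^[i] s)) (code (body (body^[i] s))) t ∧ t ≤ T)
    (hS : ∀ i ≤ n, codeSize (body^[i] s) ≤ S)
    (ht : ∀ i < n, test (body^[i] s) = true) (hf : test (body^[n] s) = false) :
    ∃ t, Run O (.loop B P) (code s) (code (body^[n] s)) t ∧ t ≤ (n + 1) * (1 + S + T + T) := by
  induction n generalizing s with
  | zero =>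
    obtain ⟨t, h1, h2⟩ := hB 0 le_rfl
    have h3 := hS 0 le_rfl
    simp only [Function.iterate_zero, _root_.id] at h1 h3 hf ⊢
    rw [hf] at h1
    refine ⟨_, Run.loop_stop h1, ?_⟩
    simp only [codeSize] at h3
    omega
  | succ n ih =>
    obtain ⟨t, h1, h2⟩ := hB 0 (Nat.zero_le _)
    obtain ⟨t', h1', h2'⟩ := hP 0 (Nat.zero_le _)
    have h3 := hS 0 (Nat.zero_le _)
    have h4 := ht 0 (Nat.succ_pos _)
    simp only [Function.iterate_zero, _root_.id] at h1 h1' h3 h4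
    rw [h4] at h1
    obtain ⟨u, h5, h6⟩ := ih (s := body s) (fun i hi => hB (i + 1) (by omega))
      (fun i hi => hP (i + 1) (by omega)) (fun i hi => hS (i + 1) (by omega))
      (fun i hi => ht (i + 1) (by omega)) hf
    refine ⟨_, .loop_step h1 (by simp [code, Enc.bool]) h1' h5, ?_⟩
    simp only [codeSize] at h3
    rw [Nat.succ_mul]
    omega

open Polynomial in
/-- Iteration with polynomially many rounds and states of polynomial size. -/
theorem loop {init : (DTree → DTree) → α → σ} {body : (DTree → DTree) → σ → σ}
    {test : (DTree → DTree) → σ → Bool} (hi : PolyTime init) (hb : PolyTime body)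
    (ht : PolyTime test) (n : (DTree → DTree) → α → ℕ)
    (htrue : ∀ O a, ∀ i < n O a, test O ((body O)^[i] (init O a)) = true)
    (hfalse : ∀ O a, test O ((body O)^[n O a] (init O a)) = false)
    (hsize : ∀ q : Polynomial ℕ, ∃ r : Polynomial ℕ, ∀ O : DTree → DTree,
      (∀ y, (O y).numNodes ≤ q.eval y.numNodes) → ∀ a, n O a ≤ r.eval (codeSize a) ∧
      ∀ i ≤ n O a, codeSize ((body O)^[i] (init O a)) ≤ r.eval (codeSize a)) :
    PolyTime fun O a => (body O)^[n O a] (init O a) := by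
  obtain ⟨I, hI⟩ := hi
  obtain ⟨P, hP⟩ := hb
  obtain ⟨B, hB⟩ := ht
  refine ⟨.seq I (.loop B P), fun q => ?_⟩
  obtain ⟨p₀, k₀⟩ := hI q
  obtain ⟨p₁, k₁⟩ := hP q
  obtain ⟨p₂, k₂⟩ := hB q
  obtain ⟨r, hr⟩ := hsize q
  -- Here `r` bounds both the number of rounds and all states, and the sum of the two composed
  -- polynomials serves as the common bound `T` for test and body.
  refine ⟨1 + X + p₀ + (r + 1) * (1 + r + (p₁.comp r + p₂.comp r) + (p₁.comp r + p₂.comp r)),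
    fun O hO a => ?_⟩
  obtain ⟨s, hs, hs'⟩ := k₀ O hO a
  obtain ⟨hr₁, hr₂⟩ := hr O hO a
  obtain ⟨t, h5, h6⟩ := exists_run_loop (O := O) (B := B) (P := P) (body := body O)
    (test := test O) (n := n O a) (s := init O a) (S := r.eval (codeSize a))
    (T := p₁.eval (r.eval (codeSize a)) + p₂.eval (r.eval (codeSize a)))
    (fun i hi => by
      obtain ⟨t, ht, ht'⟩ := k₂ O hO ((body O)^[i] (init O a))
      have := p₂.eval_le_eval_of_le (hr₂ i hi)
      exact ⟨t, ht, by omega⟩)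
    (fun i hi => by
      obtain ⟨t, ht, ht'⟩ := k₁ O hO ((body O)^[i] (init O a))
      have := p₁.eval_le_eval_of_le (hr₂ i hi)
      exact ⟨t, ht, by omega⟩)
    hr₂ (htrue O a) (hfalse O a)
  refine ⟨_, .seq hs h5, ?_⟩
  have h7 := Nat.mul_le_mul_right (1 + r.eval (codeSize a) +
    (p₁.eval (r.eval (codeSize a)) + p₂.eval (r.eval (codeSize a))) +
    (p₁.eval (r.eval (codeSize a)) + p₂.eval (r.eval (codeSize a)))) (Nat.succ_le_succ hr₁)
  simp only [codeSize, eval_add, eval_mul, eval_one, eval_X, eval_comp, Nat.succ_eq_add_one] at *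
  omega

end PolyTime

/-! ### Folds over lists, and the operations obtained from them -/

namespace PolyTime

variable {α β γ σ : Type} [TreeCode α] [TreeCode β] [TreeCode γ] [TreeCode σ]

/-- A fold is a loop on triples of the input, the remaining list and the accumulator, which stops
when the list is empty. The states that occur are folds over prefixes, so a bound on these is all
that is needed. -/
theorem foldl_of_bounded {l : (DTree → DTree) → α → List β} {init : (DTree → DTree) → α → σ}
    {step : (DTree → DTree) → α → σ → β → σ} (hl : PolyTime l) (hi : PolyTime init)
    (hs : PolyTime fun O (p : α × σ × β) => step O p.1 p.2.1 p.2.2)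
    (hsize : ∀ q : Polynomial ℕ, ∃ r : Polynomial ℕ, ∀ O : DTree → DTree,
      (∀ y, (O y).numNodes ≤ q.eval y.numNodes) → ∀ a l₁, l₁ <+: l O a →
      codeSize (l₁.foldl (step O a) (init O a)) ≤ r.eval (codeSize a)) :
    PolyTime fun O a => (l O a).foldl (fun s b => step O a s b) (init O a) := by
  let body : (DTree → DTree) → α × List β × σ → α × List β × σ := fun O p =>
    match p.2.1 with
    | [] => p
    | b :: t => (p.1, t, step O p.1 p.2.2 b)
  have hbody : PolyTime body := by
    refine cases_list (l := fun _ p => p.2.1) (G := fun _ p => p)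
      (H := fun O (x : (α × List β × σ) × β × List β) => (x.1.1, x.2.2, step O x.1.1 x.1.2.2 x.2.1))
      inferInstance inferInstance ?_ ?_ ?_
    · have : PolyTime fun O (x : (α × List β × σ) × β × List β) => step O x.1.1 x.1.2.2 x.2.1 :=
        comp hs (F := fun _ (x : (α × List β × σ) × β × List β) => (x.1.1, x.1.2.2, x.2.1))
          inferInstance
      infer_instance
    · intro O a h
      simp only [body, h]
    · intro O a b t h
      simp only [body, h]
  have htest : PolyTime fun _ (p : α × List β × σ) => !p.2.1.isEmpty := by
    refine cases_list (l := fun _ p => p.2.1) (G := fun _ _ => false)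
      (H := fun O (x : (α × List β × σ) × β × List β) => true) inferInstance inferInstance
      inferInstance ?_ ?_
    · intro O a h
      simp [h]
    · intro O a b t h
      simp [h]
  have hiter : ∀ O a i, (body O)^[i] (a, l O a, init O a) =
      (a, (l O a).drop i, ((l O a).take i).foldl (step O a) (init O a)) := by
    intro O a i
    induction i with
    | zero => simp
    | succ i ih =>
      rw [Function.iterate_succ_apply', ih]
      simp only [body]
      rcases hd : (l O a).drop i with _ | ⟨b, t⟩
      · rw [List.drop_eq_nil_iff] at hd
        simp [List.drop_eq_nil_iff.2 (hd.trans (Nat.le_succ i)), List.take_of_length_le hd,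
          List.take_of_length_le (hd.trans (Nat.le_succ i))]
      · have hlt : i < (l O a).length := by
          by_contra h
          rw [List.drop_eq_nil_iff.2 (not_lt.1 h)] at hd
          cases hd
        rw [List.drop_eq_getElem_cons hlt] at hd
        rw [List.cons.injEq] at hd
        simp only [← hd.1, ← hd.2]
        rw [List.take_add_one, List.getElem?_eq_getElem hlt, Option.toList_some, List.foldl_append]
        rfl
  have hloop := loop (init := fun O a => (a, l O a, init O a)) (body := body)
    (test := fun _ p => !p.2.1.isEmpty) (n := fun O a => (l O a).length) inferInstance hbody htest
    (fun O a i hi => by simp [hiter, List.drop_eq_nil_iff, hi]) (fun O a => by simp [hiter]) ?_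
  · simp only [hiter, List.take_length] at hloop
    exact comp (G := fun _ (p : α × List β × σ) => p.2.2) inferInstance hloop
  · intro q
    obtain ⟨pl, hpl⟩ := hl.codeSize_le q
    obtain ⟨r, hr⟩ := hsize q
    refine ⟨.X + pl + r + 2, fun O hO a => ?_⟩
    have h1 := hpl O hO a
    refine ⟨?_, fun i hi => ?_⟩
    · have := length_le_codeSize (l O a)
      simp
      omega
    · have h2 := hr O hO a _ (List.take_prefix i (l O a))
      have h3 : codeSize (l O a) = codeSize ((l O a).take i) + codeSize ((l O a).drop i) := by
        rw [← codeSize_append, List.take_append_drop]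
      simp [hiter, codeSize_prod]
      omega

/-- Folds whose states grow by a bounded amount in each step. -/
theorem foldl_of_step_le {l : (DTree → DTree) → α → List β} {init : (DTree → DTree) → α → σ}
    {step : (DTree → DTree) → α → σ → β → σ} (hl : PolyTime l) (hi : PolyTime init)
    (hs : PolyTime fun O (p : α × σ × β) => step O p.1 p.2.1 p.2.2)
    (hsize : ∀ q : Polynomial ℕ, ∃ r : Polynomial ℕ, ∀ O : DTree → DTree,
      (∀ y, (O y).numNodes ≤ q.eval y.numNodes) → ∀ a s b,
      codeSize (step O a s b) ≤ codeSize s + r.eval (codeSize (a, b))) :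
    PolyTime fun O a => (l O a).foldl (fun s b => step O a s b) (init O a) := by
  refine foldl_of_bounded hl hi hs fun q => ?_
  obtain ⟨pl, hpl⟩ := hl.codeSize_le q
  obtain ⟨pi, hpi⟩ := hi.codeSize_le q
  obtain ⟨r, hr⟩ := hsize q
  -- The polynomial `pl` bounds the number of steps as well as the size of each list element, hence
  -- also the growth in a single step.
  refine ⟨pi + pl * r.comp (.X + pl + 1), fun O hO a l₁ h₁ => ?_⟩
  obtain ⟨l₂, h₂⟩ := h₁
  have h3 := hpl O hO a
  have h4 := hpi O hO a
  rw [← h₂, codeSize_append] at h3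
  have key : ∀ (m : List β) (s : σ), codeSize m ≤ pl.eval (codeSize a) →
      codeSize (m.foldl (step O a) s) ≤
      codeSize s + m.length * r.eval (codeSize a + pl.eval (codeSize a) + 1) := by
    intro m
    induction m with
    | nil => simp
    | cons b m ih =>
      intro s hm
      rw [codeSize_cons] at hm
      have h5 := ih (step O a s b) (by omega)
      have h6 := hr O hO a s b
      have h7 := r.eval_le_eval_of_le (show codeSize (a, b) ≤
        codeSize a + pl.eval (codeSize a) + 1 by rw [codeSize_prod]; simp; omega)
      simp only [List.foldl_cons, List.length_cons, Nat.succ_mul]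
      omega
  have h5 := key l₁ (init O a) (by omega)
  have h6 := Nat.mul_le_mul_right (r.eval (codeSize a + pl.eval (codeSize a) + 1))
    ((length_le_codeSize l₁).trans (show _ ≤ pl.eval (codeSize a) by omega))
  simp only [Polynomial.eval_add, Polynomial.eval_mul, Polynomial.eval_comp, Polynomial.eval_X,
    Polynomial.eval_one]
  omega

/-! #### Truth values -/

instance cond {c : (DTree → DTree) → α → Bool} {F G : (DTree → DTree) → α → β}
    [hc : PolyTime c] [hF : PolyTime F] [hG : PolyTime G] :
    PolyTime fun O a => bif c O a then F O a else G O a :=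
  cases_code hc hG hF
    (fun O a h => by cases hca : c O a <;> simp_all [code, Enc.bool])
    (fun O a h => by cases hca : c O a <;> simp_all [code, Enc.bool])

instance not {c : (DTree → DTree) → α → Bool} [PolyTime c] : PolyTime fun O a => !c O a := by
  have : PolyTime fun O a => bif c O a then false else true := inferInstance
  convert this using 3 with O a
  cases c O a <;> rfl

instance and {c d : (DTree → DTree) → α → Bool} [PolyTime c] [PolyTime d] :
    PolyTime fun O a => c O a && d O a := by
  have : PolyTime fun O a => bif c O a then d O a else false := inferInstance
  convert this using 3 with O a
  cases c O a <;> rfl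

instance or {c d : (DTree → DTree) → α → Bool} [PolyTime c] [PolyTime d] :
    PolyTime fun O a => c O a || d O a := by
  have : PolyTime fun O a => bif c O a then true else d O a := inferInstance
  convert this using 3 with O a
  cases c O a <;> rfl

instance beq {c d : (DTree → DTree) → α → Bool} [PolyTime c] [PolyTime d] :
    PolyTime fun O a => c O a == d O a := by
  have : PolyTime fun O a => bif c O a then d O a else !d O a := inferInstance
  convert this using 3 with O a
  cases c O a <;> cases d O a <;> rfl

/-! #### Lists -/

instance listCons {b : (DTree → DTree) → α → β} {l : (DTree → DTree) → α → List β}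
    [PolyTime b] [PolyTime l] : PolyTime fun O a => b O a :: l O a :=
  of_code_eq (F := fun O a => (b O a, l O a)) inferInstance fun _ _ => rfl

instance isEmpty {l : (DTree → DTree) → α → List β} [hl : PolyTime l] :
    PolyTime fun O a => (l O a).isEmpty :=
  cases_list hl (G := fun _ _ => true) (H := fun _ _ => false) inferInstance inferInstance
    (fun O a h => by simp [h]) (fun O a b t h => by simp [h])

instance headD {l : (DTree → DTree) → α → List β} {d : (DTree → DTree) → α → β} [hl : PolyTime l]
    [PolyTime d] : PolyTime fun O a => (l O a).headD (d O a) :=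
  cases_list hl (G := d) (H := fun _ p => p.2.1) inferInstance inferInstance
    (fun O a h => by simp [h]) (fun O a b t h => by simp [h])

instance tail {l : (DTree → DTree) → α → List β} [hl : PolyTime l] :
    PolyTime fun O a => (l O a).tail :=
  cases_list hl (G := fun _ _ => []) (H := fun _ p => p.2.2) inferInstance inferInstance
    (fun O a h => by simp [h]) (fun O a b t h => by simp [h])

instance reverse {l : (DTree → DTree) → α → List β} [hl : PolyTime l] :
    PolyTime fun O a => (l O a).reverse := by
  have : PolyTime fun O a => (l O a).foldl (fun s b => b :: s) [] :=
    foldl_of_step_le hl (init := fun _ _ => []) (step := fun _ _ s b => b :: s) inferInstance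
      inferInstance fun q => ⟨.X + 1, fun O _ a s b => by
        simp [codeSize_cons, codeSize_prod]; omega⟩
  simpa using this

instance append {l m : (DTree → DTree) → α → List β} [hl : PolyTime l] [hm : PolyTime m] :
    PolyTime fun O a => l O a ++ m O a := by
  have : PolyTime fun O a => (l O a).reverse.foldl (fun s b => b :: s) (m O a) :=
    foldl_of_step_le reverse (step := fun _ _ s b => b :: s) inferInstance
      inferInstance fun q => ⟨.X + 1, fun O _ a s b => by
        simp [codeSize_cons, codeSize_prod]; omega⟩
  simpa using this

instance flatMap {l : (DTree → DTree) → α → List β} {f : (DTree → DTree) → α → β → List γ}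
    [hl : PolyTime l] [hf : PolyTime fun O (p : α × β) => f O p.1 p.2] :
    PolyTime fun O a => (l O a).flatMap fun b => f O a b := by
  have hf' : PolyTime fun O (p : α × List γ × β) => f O p.1 p.2.2 :=
    comp hf (F := fun _ (p : α × List γ × β) => (p.1, p.2.2)) inferInstance
  have : PolyTime fun O a => (l O a).foldl (fun s b => s ++ f O a b) [] :=
    foldl_of_step_le hl (init := fun _ _ => []) (step := fun O a s b => s ++ f O a b) inferInstance
      inferInstance fun q => by
        obtain ⟨r, hr⟩ := hf.codeSize_le q
        exact ⟨r, fun O hO a s b => by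
          have := hr O hO (a, b)
          simp only [codeSize_append] at *
          omega⟩
  convert this using 3 with O a
  have key : ∀ (m : List β) (s : List γ),
      m.foldl (fun s b => s ++ f O a b) s = s ++ m.flatMap fun b => f O a b := by
    intro m
    induction m with
    | nil => simp
    | cons b m ih => intro s; simp [ih]
  simp [key]

instance map {l : (DTree → DTree) → α → List β} {f : (DTree → DTree) → α → β → γ}
    [hl : PolyTime l] [hf : PolyTime fun O (p : α × β) => f O p.1 p.2] :
    PolyTime fun O a => (l O a).map fun b => f O a b := by
  have : PolyTime fun O a => (l O a).flatMap fun b => [f O a b] := inferInstance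
  convert this using 3 with O a
  induction l O a <;> simp_all

instance filter {l : (DTree → DTree) → α → List β} {f : (DTree → DTree) → α → β → Bool}
    [hl : PolyTime l] [hf : PolyTime fun O (p : α × β) => f O p.1 p.2] :
    PolyTime fun O a => (l O a).filter fun b => f O a b := by
  have : PolyTime fun O a => (l O a).flatMap fun b => bif f O a b then [b] else [] := inferInstance
  convert this using 3 with O a
  induction l O a with
  | nil => rfl
  | cons b m ih => cases h : f O a b <;> simp [h, ih]

instance any {l : (DTree → DTree) → α → List β} {f : (DTree → DTree) → α → β → Bool}
    [hl : PolyTime l] [hf : PolyTime fun O (p : α × β) => f O p.1 p.2] :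
    PolyTime fun O a => (l O a).any fun b => f O a b := by
  have : PolyTime fun O a => !((l O a).filter fun b => f O a b).isEmpty := inferInstance
  convert this using 3 with O a
  induction l O a with
  | nil => rfl
  | cons b m ih => cases h : f O a b <;> simp [h, ih]

instance all {l : (DTree → DTree) → α → List β} {f : (DTree → DTree) → α → β → Bool}
    [hl : PolyTime l] [hf : PolyTime fun O (p : α × β) => f O p.1 p.2] :
    PolyTime fun O a => (l O a).all fun b => f O a b := by
  have : PolyTime fun O a => !((l O a).any fun b => !f O a b) := inferInstance
  convert this using 3 with O a
  induction l O a with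
  | nil => rfl
  | cons b m ih => cases h : f O a b <;> simp [h, ih]

/-! #### Natural numbers in unary -/

instance length {l : (DTree → DTree) → α → List β} [hl : PolyTime l] :
    PolyTime fun O a => (l O a).length := by
  have : PolyTime fun O a => (l O a).map fun _ => () := inferInstance
  refine of_code_eq this fun O a => ?_
  simp [code, List.map_const']

instance replicate {n : (DTree → DTree) → α → ℕ} [hn : PolyTime n] :
    PolyTime fun O a => List.replicate (n O a) () :=
  of_code_eq hn fun O a => by simp [code]

instance add {m n : (DTree → DTree) → α → ℕ} [PolyTime m] [PolyTime n] :
    PolyTime fun O a => m O a + n O a := by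
  have : PolyTime fun O a =>
    (List.replicate (m O a) () ++ List.replicate (n O a) ()).length := inferInstance
  simpa using this

instance mul {m n : (DTree → DTree) → α → ℕ} [PolyTime m] [PolyTime n] :
    PolyTime fun O a => m O a * n O a := by
  have : PolyTime fun O a => ((List.replicate (m O a) ()).flatMap
    fun _ => List.replicate (n O a) ()).length := by
    have : PolyTime fun O (p : α × Unit) => n O p.1 := comp ‹PolyTime n› inferInstance
    infer_instance
  simpa using this

instance drop {n : (DTree → DTree) → α → ℕ} {l : (DTree → DTree) → α → List β} [hn : PolyTime n]
    [hl : PolyTime l] : PolyTime fun O a => (l O a).drop (n O a) := by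
  -- Dropping `n` elements means taking the tail `n` times; the unary number serves as the loop
  -- counter.
  have : PolyTime fun O a => (List.replicate (n O a) ()).foldl (fun s _ => s.tail) (l O a) :=
    foldl_of_step_le inferInstance (step := fun _ _ s _ => s.tail) hl
      inferInstance fun q => ⟨0, fun O _ a s b => by
        cases s <;> simp [codeSize_cons]; omega⟩
  convert this using 3 with O a
  generalize n O a = k
  generalize l O a = m
  induction k generalizing m with
  | zero => rfl
  | succ k ih => simp [List.replicate_succ, ← ih]

instance getD {l : (DTree → DTree) → α → List β} {n : (DTree → DTree) → α → ℕ}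
    {d : (DTree → DTree) → α → β} [hl : PolyTime l] [hn : PolyTime n] [hd : PolyTime d] :
    PolyTime fun O a => (l O a).getD (n O a) (d O a) := by
  have : PolyTime fun O a => ((l O a).drop (n O a)).headD (d O a) := inferInstance
  convert this using 3 with O a
  simp [List.headD_eq_head?_getD, List.head?_drop, List.getD_eq_getElem?_getD]

instance sub {m n : (DTree → DTree) → α → ℕ} [PolyTime m] [PolyTime n] :
    PolyTime fun O a => m O a - n O a := by
  have : PolyTime fun O a => ((List.replicate (m O a) ()).drop (n O a)).length := inferInstance
  simpa using this

instance decide_le {m n : (DTree → DTree) → α → ℕ} [PolyTime m] [PolyTime n] :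
    PolyTime fun O a => decide (m O a ≤ n O a) := by
  have : PolyTime fun O a => (List.replicate (m O a - n O a) ()).isEmpty := inferInstance
  convert this using 3 with O a
  rw [Bool.eq_iff_iff]
  simp [Nat.sub_eq_zero_iff_le]

instance decide_lt {m n : (DTree → DTree) → α → ℕ} [PolyTime m] [PolyTime n] :
    PolyTime fun O a => decide (m O a < n O a) :=
  inferInstanceAs (PolyTime fun O a => decide (m O a + 1 ≤ n O a))

instance decide_eq {m n : (DTree → DTree) → α → ℕ} [PolyTime m] [PolyTime n] :
    PolyTime fun O a => decide (m O a = n O a) := by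
  have : PolyTime fun O a => decide (m O a ≤ n O a) && decide (n O a ≤ m O a) := inferInstance
  convert this using 3 with O a
  rw [Bool.eq_iff_iff]
  simp
  omega

instance range {n : (DTree → DTree) → α → ℕ} [hn : PolyTime n] :
    PolyTime fun O a => List.range (n O a) := by
  have key : ∀ k, (List.replicate k ()).foldl (fun (s : List ℕ) _ => s ++ [s.length]) [] =
      List.range k := by
    intro k
    induction k with
    | zero => rfl
    | succ k ih => simp [List.replicate_succ', ih, List.range_succ]
  have hsize : ∀ k n : ℕ, k ≤ n → codeSize (List.range k) ≤ k * (n + 1) := by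
    intro k n hk
    induction k with
    | zero => simp [codeSize_nil]
    | succ k ih =>
      have := ih (by omega)
      rw [List.range_succ, codeSize_append, codeSize_cons, codeSize_nil, codeSize_nat, Nat.succ_mul]
      omega
  -- Each step appends the current length, so the growth depends on the state and `foldl_of_step_le`
  -- does not apply. The states are explicit ranges instead, bounded by `hsize`.
  have : PolyTime fun O a =>
      (List.replicate (n O a) ()).foldl (fun (s : List ℕ) _ => s ++ [s.length]) [] :=
    foldl_of_bounded inferInstance (init := fun _ _ => ([] : List ℕ))
      (step := fun _ _ s _ => s ++ [s.length]) inferInstance inferInstance fun q => by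
        obtain ⟨p, hp⟩ := hn.codeSize_le q
        refine ⟨p * (p + 1), fun O hO a l₁ h₁ => ?_⟩
        obtain ⟨l₂, h₂⟩ := h₁
        have h3 := congrArg List.length h₂
        have h4 := hp O hO a
        rw [codeSize_nat] at h4
        simp only [List.length_append, List.length_replicate] at h3
        have h5 : l₁ = List.replicate l₁.length () := List.eq_replicate_iff.2 ⟨rfl, by simp⟩
        rw [h5, key]
        refine (hsize _ _ (show l₁.length ≤ p.eval (codeSize a) by omega)).trans ?_
        simp only [Polynomial.eval_mul, Polynomial.eval_add, Polynomial.eval_one]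
        gcongr
        omega
  simpa only [key] using this

end PolyTime

/-! ### The algorithms -/

namespace DTree

/-- The list encoded by a tree. -/
def toList : DTree → List DTree
  | .nil => []
  | .node _ a b => a :: toList b

/-- The truth value encoded by a tree. -/
def toBool : DTree → Bool
  | .nil => false
  | .node _ _ _ => true

theorem list_toList (x : DTree) : Enc.list x.toList = x := by
  induction x with
  | nil => rfl
  | node u a b _ ih => simp [toList, Enc.list, ih]

theorem toList_list (l : List DTree) : toList (Enc.list l) = l := by
  induction l with
  | nil => rfl
  | cons a l ih => simp [toList, Enc.list, ih]

theorem toBool_bool (b : Bool) : toBool (Enc.bool b) = b := by cases b <;> rfl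

end DTree

/-- The entry of a matrix of truth values. -/
def boolEntry (M : List (List Bool)) (i j : ℕ) : Bool := (M.getD i []).getD j false

/-- The entry of a matrix of trees. -/
def treeEntry (M : List (List DTree)) (i j : ℕ) : DTree := (M.getD i []).getD j .nil

/-- The entry of a matrix of truth values that is encoded as a tree. -/
def answerEntry (y : DTree) (i j : ℕ) : Bool :=
  (((y.toList).getD i .nil).toList.getD j .nil).toBool

/-- Equality of numbers in binary. -/
def sameBits (l m : List Bool) : Bool :=
  (List.range (l.length + m.length)).all fun i => l.getD i false == m.getD i false

/-- Whether `12 * a ≤ m * b`, for numbers `a` and `b` in binary. -/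
def twelveLe (m : ℕ) (a b : List Bool) : Bool :=
  decide (12 ≤ (List.range (a.length + b.length)).foldl (fun e i =>
    (e + ((bif b.getD i false then m else 0) + (bif a.getD i false then 0 else 12))) / 2) 12)

/-- The encoding of the fraction `(a - b) / d` in lowest terms. -/
def fractionBits (a b d : ℕ) : (Bool × List Bool) × List Bool :=
  ((decide (a < b), (a - b + (b - a)).bits), d.bits)

/-! #### From Exact Perfect Matching to games -/

/-- Edges of the graph with the given matrices of red and blue edges. -/
def isEdge (R B : List (List Bool)) (i j : ℕ) : Bool := boolEntry R i j || boolEntry B i j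

/-- The arcs between `(i, j)` and `(k, l)` in the gadget graph. -/
def gadgetArc (R B : List (List Bool)) (i j k l : ℕ) : Bool :=
  (!decide (i = j) && (decide (k = j) && decide (l = i))) ||
    ((decide (i = j) && (decide (k = i) && isEdge R B k l)) ||
      (decide (k = l) && (decide (i = k) && isEdge R B i j)))

/-- The encoded weight of the arc from `(i, j)` to `(k, l)` in the gadget game. -/
def gadgetWeight (R B : List (List Bool)) (i j k l : ℕ) : DTree :=
  bif gadgetArc R B i j k l then
    bif boolEntry R i j == boolEntry R k l then Enc.rat (1 / 2)
    else bif boolEntry R i j then Enc.rat (2 / 3) else Enc.rat (1 / 3)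
  else Enc.rat 0

/-- The encoded row of the weight matrix of the gadget game. -/
def gadgetRow (R B : List (List Bool)) (i j : ℕ) : List DTree :=
  (List.range R.length).flatMap fun k => (List.range R.length).map fun l => gadgetWeight R B i j k l

/-- The encoded weight matrix of the gadget game. -/
def gadgetMatrix (R B : List (List Bool)) : List (List DTree) :=
  (List.range R.length).flatMap fun i => (List.range R.length).map fun j => gadgetRow R B i j

/-- The encoded partition of the gadget game. -/
def gadgetParts (R : List (List Bool)) : List Bool :=
  (List.range R.length).flatMap fun i => (List.range R.length).map fun j => boolEntry R i j

/-- The number of entries of `l` that are equal to `b`. -/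
def countBool (b : Bool) (l : List Bool) : ℕ := (l.filter fun c => c == b).length

/-- The encoded gadget game with the target for `k` red edges. -/
def gadgetInstance (R B : List (List Bool)) (k : ℕ) : DTree :=
  code (gadgetMatrix R B, gadgetParts R,
    fractionBits (9 * countBool false (gadgetParts R) + 6 * k) 1 18,
    fractionBits (9 * countBool true (gadgetParts R) + 1) (6 * k) 18)

/-- The matching of the original graph that is read off from a matching `y` of the gadget. -/
def readOff (R B : List (List Bool)) (y : DTree) (i j : ℕ) : Bool :=
  answerEntry y (R.length * i + i) (R.length * i + j) &&
    (answerEntry y (R.length * j + j) (R.length * j + i) && isEdge R B i j)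

/-- Whether the edges read off from `y` are a perfect matching with `k` red edges. -/
def verify (R B : List (List Bool)) (y : DTree) (k : ℕ) : Bool :=
  ((List.range R.length).all fun i =>
    decide (((List.range R.length).filter fun j => readOff R B y i j).length = 1)) &&
  decide (((List.range R.length).flatMap fun i => (List.range R.length).filter fun j =>
    readOff R B y i j && boolEntry R i j).length = k + k)

/-- Exact Perfect Matching by queries for minimal matchings. -/
def solveMatching (O : DTree → DTree) (R B : List (List Bool)) (k : List Bool) : Bool :=
  (List.range (R.length + 1)).any fun m =>
    sameBits m.bits k && verify R B (O (gadgetInstance R B m)) m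

/-! #### From games to Exact Perfect Matching -/

/-- Edges of the compatibility graph of a game, from its encoded weights. -/
def gameEdge (W : List (List DTree)) (i j : ℕ) : Bool :=
  (treeEntry W i j).hd.tl.toBool && (treeEntry W j i).hd.tl.toBool

/-- Whether the pair `ij` is not among the deleted pairs `L`. -/
def isKept (L : List (ℕ × ℕ)) (i j : ℕ) : Bool :=
  L.all fun p => !((decide (p.1 = i) && decide (p.2 = j)) || (decide (p.1 = j) && decide (p.2 = i)))

/-- The matrix of the edges that are not deleted and whose ends are in the same part, or in
different parts. -/
def keptMatrix (W : List (List DTree)) (parts : List Bool) (L : List (ℕ × ℕ)) (same : Bool) :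
    List (List Bool) :=
  (List.range parts.length).map fun i => (List.range parts.length).map fun j =>
    (gameEdge W i j && isKept L i j) && ((parts.getD i false == parts.getD j false) == same)

/-- Whether the graph without the pairs `L` has a perfect matching with `c` crossing edges. -/
def achievable (O : DTree → DTree) (W : List (List DTree)) (parts : List Bool) (L : List (ℕ × ℕ))
    (c : ℕ) : Bool :=
  (O (code (keptMatrix W parts L false, keptMatrix W parts L true, c.bits))).toBool

/-- Whether `b` crossing edges are at least as good for the target `x` as `c > b`. -/
def isPreferred (parts : List Bool) (x : (Bool × List Bool) × List Bool) (b c : ℕ) : Bool :=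
  x.1.1 || twelveLe (6 * countBool false parts + (b + c)) x.1.2 x.2

/-- The numbers of crossing edges of perfect matchings. -/
def achievableList (O : DTree → DTree) (W : List (List DTree)) (parts : List Bool) : List ℕ :=
  (List.range (parts.length + 1)).filter fun c => achievable O W parts [] c

/-- The best number of crossing edges. -/
def bestNumber (O : DTree → DTree) (W : List (List DTree)) (parts : List Bool)
    (x : (Bool × List Bool) × List Bool) : ℕ :=
  (achievableList O W parts).foldl (fun b c => bif isPreferred parts x b c then b else c)
    ((achievableList O W parts).headD 0)

/-- Greedy deletion of edges, with `c` crossing edges. -/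
def deletedPairs (O : DTree → DTree) (W : List (List DTree)) (parts : List Bool) (c : ℕ) :
    List (ℕ × ℕ) :=
  ((List.range parts.length).flatMap fun i => (List.range parts.length).map fun j => (i, j)).foldl
    (fun L p => bif achievable O W parts (p :: L) c then p :: L else L) []

/-- The matrix of the edges that are not deleted. -/
def remainingMatrix (W : List (List DTree)) (parts : List Bool) (L : List (ℕ × ℕ)) :
    List (List Bool) :=
  (List.range parts.length).map fun i => (List.range parts.length).map fun j =>
    gameEdge W i j && isKept L i j

/-- Minimal matchings by queries for exact perfect matchings. -/
def solveGame (O : DTree → DTree) (W : List (List DTree)) (parts : List Bool)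
    (x : (Bool × List Bool) × List Bool) : List (List Bool) :=
  remainingMatrix W parts (deletedPairs O W parts (bestNumber O W parts x))

theorem Nat.bits_of_ne_zero {n : ℕ} (h : n ≠ 0) :
    n.bits = decide (n % 2 = 1) :: (n / 2).bits := by
  conv_lhs => rw [← Nat.bit_bodd_div2 n]
  rw [Nat.bits_append_bit _ _ (by
    intro h2
    rw [Nat.div2_val] at h2
    have : n = 1 := by omega
    subst this
    rfl), Nat.div2_val]
  congr 1
  rw [Nat.mod_two_of_bodd]
  cases n.bodd <;> simp

/-! ### The algorithms run in polynomial time -/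

namespace PolyTime

set_option synthInstance.maxSize 100000
set_option synthInstance.maxHeartbeats 200000

variable {α β γ σ : Type} [TreeCode α] [TreeCode β] [TreeCode γ] [TreeCode σ]

instance toList {F : (DTree → DTree) → α → DTree} [hF : PolyTime F] :
    PolyTime fun O a => (F O a).toList :=
  of_code_eq hF fun O a => by
    conv_rhs => rw [← DTree.list_toList (F O a)]
    simp [code]

instance toBool {F : (DTree → DTree) → α → DTree} [hF : PolyTime F] :
    PolyTime fun O a => (F O a).toBool :=
  cases_code hF (G := fun _ _ => false) (H := fun _ _ => true) inferInstance inferInstance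
    (fun O a h => by cases hF : F O a <;> simp_all [code, DTree.toBool])
    (fun O a h => by cases hF : F O a <;> simp_all [code, DTree.toBool])

instance treeHd {F : (DTree → DTree) → α → DTree} [hF : PolyTime F] :
    PolyTime fun O a => (F O a).hd := by
  have : PolyTime fun O a => (F O a).toList.headD .nil := inferInstance
  convert this using 3 with O a
  cases F O a <;> rfl

instance treeTl {F : (DTree → DTree) → α → DTree} [hF : PolyTime F] :
    PolyTime fun O a => (F O a).tl := by
  have : PolyTime fun O a => (F O a).toList.tail := inferInstance
  refine of_code_eq this fun O a => ?_
  cases h : F O a with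
  | nil => rfl
  | node u x y =>
    conv_lhs => rw [DTree.tl, ← DTree.list_toList y]
    simp [code, DTree.toList]

instance ofCode {F : (DTree → DTree) → α → β} [hF : PolyTime F] :
    PolyTime fun O a => code (F O a) :=
  of_code_eq hF fun _ _ => rfl

instance div_two {n : (DTree → DTree) → α → ℕ} [hn : PolyTime n] :
    PolyTime fun O a => n O a / 2 := by
  -- The numbers `i` with `2 * i + 2 ≤ n` are exactly those below `n / 2`, so halving is counting.
  have : PolyTime fun O a =>
      ((List.range (n O a)).filter fun i => decide (i + i + 2 ≤ n O a)).length := by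
    have : PolyTime fun O (p : α × ℕ) => n O p.1 := comp hn inferInstance
    infer_instance
  convert this using 3 with O a
  generalize n O a = k
  have : (List.range k).filter (fun i => decide (i + i + 2 ≤ k)) = List.range (k / 2) := by
    obtain ⟨d, hd⟩ := Nat.exists_eq_add_of_le (Nat.div_le_self k 2)
    rw [hd, List.range_add, List.filter_append, ← hd]
    rw [List.filter_eq_self.2, List.filter_eq_nil_iff.2, List.append_nil]
    · simp
      omega
    · simp
      omega
  simp [this]

instance bits {n : (DTree → DTree) → α → ℕ} [hn : PolyTime n] :
    PolyTime fun O a => (n O a).bits := by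
  -- One step halves the number and appends its parity, tested by comparing the number with twice
  -- its half. Running `n` rounds is more than enough, since steps at zero do nothing.
  let step : ℕ × List Bool → ℕ × List Bool := fun s => bif decide (s.1 = 0) then s else
    (s.1 / 2, s.2 ++ [!decide (s.1 = s.1 / 2 + s.1 / 2)])
  have : PolyTime fun O a => ((List.replicate (n O a) ()).foldl
      (fun s _ => step s) (n O a, [])).2 := by
    have : PolyTime fun O a => (List.replicate (n O a) ()).foldl (fun s _ => step s) (n O a, []) := by
      refine foldl_of_step_le (init := fun O a => (n O a, [])) (step := fun _ _ s _ => step s)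
        inferInstance inferInstance inferInstance fun q => ⟨2, fun O _ a s b => ?_⟩
      rcases Nat.eq_zero_or_pos s.1 with h | h
      · simp [step, h]
      · simp only [step, h.ne', decide_false, cond_false, codeSize_prod, codeSize_append,
          codeSize_cons, codeSize_nil, codeSize_nat, Polynomial.eval_ofNat]
        have := codeSize_bool_le (!decide (s.1 = s.1 / 2 + s.1 / 2))
        have := Nat.div_le_self s.1 2
        omega
    infer_instance
  convert this using 3 with O a
  generalize n O a = m
  have key : ∀ (k : ℕ) (s : ℕ × List Bool), s.1 ≤ k →
      ((List.replicate k ()).foldl (fun s _ => step s) s).2 = s.2 ++ s.1.bits := by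
    intro k
    induction k with
    | zero =>
      intro s hs
      simp [Nat.le_zero.1 hs]
    | succ k ih =>
      intro s hs
      rw [List.replicate_succ, List.foldl_cons]
      rcases Nat.eq_zero_or_pos s.1 with h | h
      · have hst : step s = s := by simp [step, h]
        rw [hst]
        exact ih s (by omega)
      · have hst : step s = (s.1 / 2, s.2 ++ [!decide (s.1 = s.1 / 2 + s.1 / 2)]) := by
          simp [step, h.ne']
        rw [hst, ih _ (by simp; omega), Nat.bits_of_ne_zero h.ne']
        have : (!decide (s.1 = s.1 / 2 + s.1 / 2)) = decide (s.1 % 2 = 1) := by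
          rw [Bool.eq_iff_iff]
          simp
          omega
        simp [this]
  rw [key m (m, []) le_rfl]
  rfl

instance boolEntry {M : (DTree → DTree) → α → List (List Bool)} {i j : (DTree → DTree) → α → ℕ}
    [PolyTime M] [PolyTime i] [PolyTime j] :
    PolyTime fun O a => _root_.boolEntry (M O a) (i O a) (j O a) := by
  unfold _root_.boolEntry
  infer_instance

instance treeEntry {M : (DTree → DTree) → α → List (List DTree)} {i j : (DTree → DTree) → α → ℕ}
    [PolyTime M] [PolyTime i] [PolyTime j] :
    PolyTime fun O a => _root_.treeEntry (M O a) (i O a) (j O a) := by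
  unfold _root_.treeEntry
  infer_instance

instance answerEntry {y : (DTree → DTree) → α → DTree} {i j : (DTree → DTree) → α → ℕ}
    [PolyTime y] [PolyTime i] [PolyTime j] :
    PolyTime fun O a => _root_.answerEntry (y O a) (i O a) (j O a) := by
  unfold _root_.answerEntry
  infer_instance

/-- Passing to a tuple of arguments replaces arbitrary functions of `a` by projections, so that the
functions under list binders are found to be polynomial-time by instance search. The same device
recurs below. -/
instance sameBits {l m : (DTree → DTree) → α → List Bool} [PolyTime l] [PolyTime m] :
    PolyTime fun O a => _root_.sameBits (l O a) (m O a) :=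
  comp (G := fun _ (x : List Bool × List Bool) => _root_.sameBits x.1 x.2)
    (by unfold _root_.sameBits; infer_instance) (F := fun O a => (l O a, m O a)) inferInstance

instance twelveLe {m : (DTree → DTree) → α → ℕ} {l l' : (DTree → DTree) → α → List Bool}
    [PolyTime m] [PolyTime l] [PolyTime l'] :
    PolyTime fun O a => _root_.twelveLe (m O a) (l O a) (l' O a) := by
  refine comp (G := fun _ (x : ℕ × List Bool × List Bool) => _root_.twelveLe x.1 x.2.1 x.2.2)
    ?_ (F := fun O a => (m O a, l O a, l' O a)) inferInstance
  unfold _root_.twelveLe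
  have hs : PolyTime fun _ (p : (ℕ × List Bool × List Bool) × ℕ × ℕ) => (p.2.1 +
      ((bif p.1.2.2.getD p.2.2 false then p.1.1 else 0) +
        (bif p.1.2.1.getD p.2.2 false then 0 else 12))) / 2 := inferInstance
  have := foldl_of_step_le (l := fun _ x => List.range (x.2.1.length + x.2.2.length))
    (init := fun _ _ => (12 : ℕ)) (step := fun _ (x : ℕ × List Bool × List Bool) e i =>
      (e + ((bif x.2.2.getD i false then x.1 else 0) +
        (bif x.2.1.getD i false then 0 else 12))) / 2) inferInstance inferInstance hs
    -- The accumulator is unary, but every step halves it after adding at most `m + 12`, so it stays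
    -- small although the compared numbers are binary.
    fun q => ⟨.X + 12, fun O _ a s b => by
      simp only [codeSize_nat, codeSize_prod, Polynomial.eval_add, Polynomial.eval_X,
        Polynomial.eval_ofNat]
      cases a.2.2.getD b false <;> cases a.2.1.getD b false <;> simp <;> omega⟩
  infer_instance

instance fractionBits {a b d : (DTree → DTree) → α → ℕ} [PolyTime a] [PolyTime b] [PolyTime d] :
    PolyTime fun O x => _root_.fractionBits (a O x) (b O x) (d O x) := by
  unfold _root_.fractionBits
  infer_instance

instance isEdge {R B : (DTree → DTree) → α → List (List Bool)} {i j : (DTree → DTree) → α → ℕ}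
    [PolyTime R] [PolyTime B] [PolyTime i] [PolyTime j] :
    PolyTime fun O a => _root_.isEdge (R O a) (B O a) (i O a) (j O a) := by
  unfold _root_.isEdge
  infer_instance

instance gadgetArc {R B : (DTree → DTree) → α → List (List Bool)}
    {i j k l : (DTree → DTree) → α → ℕ}
    [PolyTime R] [PolyTime B] [PolyTime i] [PolyTime j] [PolyTime k] [PolyTime l] :
    PolyTime fun O a => _root_.gadgetArc (R O a) (B O a) (i O a) (j O a) (k O a) (l O a) := by
  unfold _root_.gadgetArc
  infer_instance

instance gadgetWeight {R B : (DTree → DTree) → α → List (List Bool)}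
    {i j k l : (DTree → DTree) → α → ℕ}
    [PolyTime R] [PolyTime B] [PolyTime i] [PolyTime j] [PolyTime k] [PolyTime l] :
    PolyTime fun O a => _root_.gadgetWeight (R O a) (B O a) (i O a) (j O a) (k O a) (l O a) := by
  unfold _root_.gadgetWeight
  infer_instance

instance gadgetRow {R B : (DTree → DTree) → α → List (List Bool)}
    {i j : (DTree → DTree) → α → ℕ} [PolyTime R] [PolyTime B] [PolyTime i] [PolyTime j] :
    PolyTime fun O a => _root_.gadgetRow (R O a) (B O a) (i O a) (j O a) :=
  comp (G := fun _ (x : (List (List Bool) × List (List Bool)) × ℕ × ℕ) =>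
    _root_.gadgetRow x.1.1 x.1.2 x.2.1 x.2.2) (by unfold _root_.gadgetRow; infer_instance)
    (F := fun O a => ((R O a, B O a), (i O a, j O a))) inferInstance

instance gadgetMatrix {R B : (DTree → DTree) → α → List (List Bool)} [PolyTime R] [PolyTime B] :
    PolyTime fun O a => _root_.gadgetMatrix (R O a) (B O a) :=
  comp (G := fun _ (x : List (List Bool) × List (List Bool)) => _root_.gadgetMatrix x.1 x.2)
    (by unfold _root_.gadgetMatrix; infer_instance) (F := fun O a => (R O a, B O a)) inferInstance

instance gadgetParts {R : (DTree → DTree) → α → List (List Bool)} [hR : PolyTime R] :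
    PolyTime fun O a => _root_.gadgetParts (R O a) :=
  comp (G := fun _ (x : List (List Bool)) => _root_.gadgetParts x)
    (by unfold _root_.gadgetParts; infer_instance) hR

instance countBool {b : Bool} {l : (DTree → DTree) → α → List Bool} [PolyTime l] :
    PolyTime fun O a => _root_.countBool b (l O a) := by
  unfold _root_.countBool
  infer_instance

instance gadgetInstance {R B : (DTree → DTree) → α → List (List Bool)}
    {k : (DTree → DTree) → α → ℕ} [PolyTime R] [PolyTime B] [PolyTime k] :
    PolyTime fun O a => _root_.gadgetInstance (R O a) (B O a) (k O a) := by
  unfold _root_.gadgetInstance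
  infer_instance

instance readOff {R B : (DTree → DTree) → α → List (List Bool)} {y : (DTree → DTree) → α → DTree}
    {i j : (DTree → DTree) → α → ℕ} [PolyTime R] [PolyTime B] [PolyTime y] [PolyTime i]
    [PolyTime j] : PolyTime fun O a => _root_.readOff (R O a) (B O a) (y O a) (i O a) (j O a) := by
  unfold _root_.readOff
  infer_instance

instance verify {R B : (DTree → DTree) → α → List (List Bool)} {y : (DTree → DTree) → α → DTree}
    {k : (DTree → DTree) → α → ℕ} [PolyTime R] [PolyTime B] [PolyTime y] [PolyTime k] :
    PolyTime fun O a => _root_.verify (R O a) (B O a) (y O a) (k O a) :=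
  comp (G := fun _ (x : (List (List Bool) × List (List Bool)) × DTree × ℕ) =>
    _root_.verify x.1.1 x.1.2 x.2.1 x.2.2) (by unfold _root_.verify; infer_instance)
    (F := fun O a => ((R O a, B O a), (y O a, k O a))) inferInstance

theorem solveMatching : PolyTime fun O (x : List (List Bool) × List (List Bool) × List Bool) =>
    _root_.solveMatching O x.1 x.2.1 x.2.2 := by
  unfold _root_.solveMatching
  infer_instance

instance gameEdge {W : (DTree → DTree) → α → List (List DTree)} {i j : (DTree → DTree) → α → ℕ}
    [PolyTime W] [PolyTime i] [PolyTime j] :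
    PolyTime fun O a => _root_.gameEdge (W O a) (i O a) (j O a) := by
  unfold _root_.gameEdge
  infer_instance

instance isKept {L : (DTree → DTree) → α → List (ℕ × ℕ)} {i j : (DTree → DTree) → α → ℕ}
    [PolyTime L] [PolyTime i] [PolyTime j] :
    PolyTime fun O a => _root_.isKept (L O a) (i O a) (j O a) :=
  comp (G := fun _ (x : List (ℕ × ℕ) × ℕ × ℕ) => _root_.isKept x.1 x.2.1 x.2.2)
    (by unfold _root_.isKept; infer_instance) (F := fun O a => (L O a, i O a, j O a)) inferInstance

instance keptMatrix {W : (DTree → DTree) → α → List (List DTree)}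
    {parts : (DTree → DTree) → α → List Bool} {L : (DTree → DTree) → α → List (ℕ × ℕ)} {b : Bool}
    [PolyTime W] [PolyTime parts] [PolyTime L] :
    PolyTime fun O a => _root_.keptMatrix (W O a) (parts O a) (L O a) b :=
  comp (G := fun _ (x : List (List DTree) × List Bool × List (ℕ × ℕ)) =>
    _root_.keptMatrix x.1 x.2.1 x.2.2 b) (by unfold _root_.keptMatrix; infer_instance)
    (F := fun O a => (W O a, parts O a, L O a)) inferInstance

instance achievable {W : (DTree → DTree) → α → List (List DTree)}
    {parts : (DTree → DTree) → α → List Bool} {L : (DTree → DTree) → α → List (ℕ × ℕ)}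
    {c : (DTree → DTree) → α → ℕ} [PolyTime W] [PolyTime parts] [PolyTime L] [PolyTime c] :
    PolyTime fun O a => _root_.achievable O (W O a) (parts O a) (L O a) (c O a) := by
  unfold _root_.achievable
  infer_instance

instance isPreferred {parts : (DTree → DTree) → α → List Bool}
    {x : (DTree → DTree) → α → (Bool × List Bool) × List Bool} {b c : (DTree → DTree) → α → ℕ}
    [PolyTime parts] [PolyTime x] [PolyTime b] [PolyTime c] :
    PolyTime fun O a => _root_.isPreferred (parts O a) (x O a) (b O a) (c O a) := by
  unfold _root_.isPreferred
  infer_instance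

instance achievableList {W : (DTree → DTree) → α → List (List DTree)}
    {parts : (DTree → DTree) → α → List Bool} [PolyTime W] [PolyTime parts] :
    PolyTime fun O a => _root_.achievableList O (W O a) (parts O a) :=
  comp (G := fun O (x : List (List DTree) × List Bool) => _root_.achievableList O x.1 x.2)
    (by unfold _root_.achievableList; infer_instance) (F := fun O a => (W O a, parts O a))
    inferInstance

instance bestNumber {W : (DTree → DTree) → α → List (List DTree)}
    {parts : (DTree → DTree) → α → List Bool}
    {x : (DTree → DTree) → α → (Bool × List Bool) × List Bool}
    [PolyTime W] [PolyTime parts] [PolyTime x] :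
    PolyTime fun O a => _root_.bestNumber O (W O a) (parts O a) (x O a) := by
  refine comp (G := fun O (x : List (List DTree) × List Bool × (Bool × List Bool) × List Bool) =>
    _root_.bestNumber O x.1 x.2.1 x.2.2) ?_ (F := fun O a => (W O a, parts O a, x O a)) inferInstance
  unfold _root_.bestNumber
  -- The new state is either the old one or the list element, so its size is at most the sum of
  -- both.
  refine foldl_of_step_le
    (step := fun _ (x : List (List DTree) × List Bool × (Bool × List Bool) × List Bool) b c => bif _root_.isPreferred x.2.1 x.2.2 b c then b else c)
    inferInstance inferInstance inferInstance fun q => ⟨.X, fun O _ a s b => ?_⟩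
  simp only [codeSize_prod a, codeSize_prod (a, b), Polynomial.eval_X]
  cases _root_.isPreferred a.2.1 a.2.2 s b <;> simp
  omega

instance deletedPairs {W : (DTree → DTree) → α → List (List DTree)}
    {parts : (DTree → DTree) → α → List Bool} {c : (DTree → DTree) → α → ℕ}
    [PolyTime W] [PolyTime parts] [PolyTime c] :
    PolyTime fun O a => _root_.deletedPairs O (W O a) (parts O a) (c O a) := by
  refine comp (G := fun O (x : List (List DTree) × List Bool × ℕ) =>
    _root_.deletedPairs O x.1 x.2.1 x.2.2) ?_ (F := fun O a => (W O a, parts O a, c O a))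
    inferInstance
  unfold _root_.deletedPairs
  refine foldl_of_step_le (step := fun O (x : List (List DTree) × List Bool × ℕ) L p =>
    bif _root_.achievable O x.1 x.2.1 (p :: L) x.2.2 then p :: L else L)
    inferInstance inferInstance inferInstance fun q => ⟨.X, fun O _ a s b => ?_⟩
  simp only [codeSize_prod (a, b), Polynomial.eval_X]
  cases _root_.achievable O a.1 a.2.1 (b :: s) a.2.2 <;> simp [codeSize_cons]
  omega

instance remainingMatrix {W : (DTree → DTree) → α → List (List DTree)}
    {parts : (DTree → DTree) → α → List Bool} {L : (DTree → DTree) → α → List (ℕ × ℕ)}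
    [PolyTime W] [PolyTime parts] [PolyTime L] :
    PolyTime fun O a => _root_.remainingMatrix (W O a) (parts O a) (L O a) :=
  comp (G := fun _ (x : List (List DTree) × List Bool × List (ℕ × ℕ)) =>
    _root_.remainingMatrix x.1 x.2.1 x.2.2) (by unfold _root_.remainingMatrix; infer_instance)
    (F := fun O a => (W O a, parts O a, L O a)) inferInstance

theorem solveGame : PolyTime fun O
    (x : List (List DTree) × List Bool × ((Bool × List Bool) × List Bool) ×
      (Bool × List Bool) × List Bool) => _root_.solveGame O x.1 x.2.1 x.2.2.1 := by
  unfold _root_.solveGame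
  infer_instance

end PolyTime

/-! ### Matchings and perfect games -/

open Classical in
/-- The sum of the degrees, restricted to a set of edges, is twice the number of edges. -/
theorem SimpleGraph.Subgraph.sum_card_adj_eq {V : Type} [Fintype V] {G : SimpleGraph V}
    (M : G.Subgraph) (S : Set (Sym2 V)) :
    ∑ i, (Finset.univ.filter fun j => M.Adj i j ∧ s(i, j) ∈ S).card =
      2 * (M.edgeSet ∩ S).ncard := by
  let H : SimpleGraph V :=
    { Adj := fun i j => M.Adj i j ∧ s(i, j) ∈ S
      symm := ⟨fun i j h => ⟨h.1.symm, Sym2.eq_swap ▸ h.2⟩⟩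
      loopless := ⟨fun i h => G.loopless.irrefl i (M.adj_sub h.1)⟩ }
  have hE : H.edgeSet = M.edgeSet ∩ S := by
    ext e
    induction e with
    | _ i j => simp [H]
  have hd := H.sum_degrees_eq_twice_card_edges
  rw [← hE, Set.ncard_eq_toFinset_card', ← SimpleGraph.edgeFinset, ← hd]
  refine Finset.sum_congr rfl fun i _ => ?_
  rw [← SimpleGraph.card_neighborFinset_eq_degree]
  congr 1
  ext j
  simp [H]

open Classical in
theorem SimpleGraph.Subgraph.IsMatching.card_adj {V : Type} [Fintype V] {G : SimpleGraph V}
    {M : G.Subgraph} (hM : M.IsMatching) (i : V) :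
    (Finset.univ.filter fun j => M.Adj i j).card = if i ∈ M.verts then 1 else 0 := by
  split_ifs with hi
  · rw [Finset.card_eq_one]
    obtain ⟨j, hj, hj'⟩ := hM hi
    exact ⟨j, by ext k; simpa using ⟨hj' k, fun h => h ▸ hj⟩⟩
  · rw [Finset.card_eq_zero, Finset.filter_eq_empty_iff]
    exact fun j _ h => hi (M.edge_vert h)

/-- A perfect matching is given by an involution. -/
theorem SimpleGraph.Subgraph.IsPerfectMatching.exists_involutive {V : Type} {G : SimpleGraph V}
    {M : G.Subgraph} (hM : M.IsPerfectMatching) :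
    ∃ f : V → V, Function.Involutive f ∧ ∀ i j, M.Adj i j ↔ f i = j := by
  rw [SimpleGraph.Subgraph.isPerfectMatching_iff] at hM
  choose f hf hf' using hM
  refine ⟨f, fun i => (hf' (f i) i (hf i).symm).symm, fun i j => ⟨fun h => (hf' i j h).symm, ?_⟩⟩
  rintro rfl
  exact hf i

/-! ### Weights and shares in perfect games -/

namespace DirPMGame

variable {V : Type} {Γ : DirPMGame V (Fin 2)}

/-- The edges between the two parts. -/
def crossing (Γ : DirPMGame V (Fin 2)) : Set (Sym2 V) :=
  Sym2.fromRel (r := fun i j => Γ.part i ≠ Γ.part j) ⟨fun _ _ h => h.symm⟩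

open Classical in
/-- The number of vertices of player `0`. -/
noncomputable def size [Fintype V] (Γ : DirPMGame V (Fin 2)) : ℕ :=
  (Finset.univ.filter fun i => Γ.part i = 0).card

theorem mem_crossing {i j : V} : s(i, j) ∈ Γ.crossing ↔ Γ.part i ≠ Γ.part j := by
  simp [crossing]

theorem part_eq (Γ : DirPMGame V (Fin 2)) (i : V) : Γ.part i = 0 ∨ Γ.part i = 1 := by
  omega

theorem IsPerfect.w_eq (h : Γ.IsPerfect) {i j : V} (hij : Γ.graph.Adj i j) :
    Γ.w i j = if Γ.part i = Γ.part j then 1 / 2 else if Γ.part j = 0 then 2 / 3 else 1 / 3 := by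
  obtain ⟨h1, h2, -⟩ := h
  rcases Γ.part_eq i with hi | hi <;> rcases Γ.part_eq j with hj | hj
  · simp [h2 i j hij (hi.trans hj.symm), hi, hj]
  · simp [h1 i j hij hi hj, hi, hj]
  · simp [h1 j i hij.symm hj hi, hi, hj]
  · simp [h2 i j hij (hi.trans hj.symm), hi, hj]

theorem IsPerfect.w_add_w (h : Γ.IsPerfect) {i j : V} (hij : Γ.graph.Adj i j) :
    Γ.w i j + Γ.w j i = 1 := by
  rw [h.w_eq hij, h.w_eq hij.symm]
  rcases Γ.part_eq i with hi | hi <;> rcases Γ.part_eq j with hj | hj <;> norm_num [hi, hj]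

variable [Fintype V]

open Classical in
/-- The weight of a matching is half of the number of its vertices. -/
theorem IsPerfect.two_mul_weight (h : Γ.IsPerfect) {M : Γ.graph.Subgraph} (hM : M.IsMatching) :
    2 * Γ.weight M = (Finset.univ.filter fun i => i ∈ M.verts).card := by
  have h1 : Γ.weight M = M.edgeSet.ncard := by
    rw [weight, Finset.sum_congr rfl (g := fun _ => 1), Set.ncard_eq_toFinset_card']
    · simp only [Finset.sum_const, nsmul_eq_mul, mul_one, Nat.cast_inj]
      congr 1
      ext e
      simp
    · intro e he
      induction e with
      | _ i j =>
        simp only [Finset.mem_filter, SimpleGraph.Subgraph.mem_edgeSet] at he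
        exact h.w_add_w (M.adj_sub he.2)
  have h2 := M.sum_card_adj_eq Set.univ
  simp only [Set.mem_univ, and_true, Set.inter_univ, hM.card_adj] at h2
  rw [h1, Finset.card_filter]
  exact_mod_cast h2.symm

theorem IsPerfect.two_mul_weight_of_isPerfectMatching (h : Γ.IsPerfect) {M : Γ.graph.Subgraph}
    (hM : M.IsPerfectMatching) : 2 * Γ.weight M = Fintype.card V := by
  classical
  rw [h.two_mul_weight hM.1, Finset.filter_true_of_mem fun i _ => hM.2 i, Finset.card_univ]

theorem IsPerfect.two_mul_weight_le (h : Γ.IsPerfect) {M : Γ.graph.Subgraph}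
    (hM : M.IsMatching) : 2 * Γ.weight M ≤ Fintype.card V := by
  classical
  rw [h.two_mul_weight hM]
  exact_mod_cast Finset.card_le_univ _

/-- The weight is half the number of covered vertices, hence at most half of all vertices. The
perfect matching that exists by assumption attains this bound, and only covering everything does. -/
theorem IsPerfect.isMaxWeightMatching_iff (h : Γ.IsPerfect) {M : Γ.graph.Subgraph} :
    Γ.IsMaxWeightMatching M ↔ M.IsPerfectMatching := by
  classical
  obtain ⟨M₀, hM₀⟩ := h.2.2
  have h0 := h.two_mul_weight_of_isPerfectMatching hM₀
  constructor
  · rintro ⟨hM, hmax⟩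
    refine ⟨hM, fun i => ?_⟩
    have h1 := hmax M₀ hM₀.1
    have h2 := h.two_mul_weight hM
    have h3 : Fintype.card V ≤ (Finset.univ.filter fun i => i ∈ M.verts).card := by
      have : (Fintype.card V : ℚ) ≤ (Finset.univ.filter fun i => i ∈ M.verts).card := by linarith
      exact_mod_cast this
    have h4 := Finset.eq_univ_of_card _ (le_antisymm (Finset.card_le_univ _) h3)
    have h5 := Finset.mem_univ i
    rw [← h4] at h5
    simpa using h5
  · intro hM
    refine ⟨hM.1, fun M' hM' => ?_⟩
    have h1 := h.two_mul_weight_of_isPerfectMatching hM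
    have h2 := h.two_mul_weight_le hM'
    linarith

theorem IsPerfect.two_mul_value (h : Γ.IsPerfect) :
    2 * Γ.value Set.univ = Fintype.card V := by
  obtain ⟨M₀, hM₀⟩ := h.2.2
  have h0 := h.two_mul_weight_of_isPerfectMatching hM₀
  have h1 : Γ.weight M₀ ≤ Γ.value Set.univ :=
    Finset.le_sup' Γ.weight (by simp [coalitionMatchings, hM₀.1])
  have h2 : Γ.value Set.univ ≤ Γ.weight M₀ := by
    refine Finset.sup'_le _ _ fun M hM => ?_
    simp only [coalitionMatchings, Set.Finite.mem_toFinset, Set.mem_ofPred_eq] at hM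
    have h3 := h.two_mul_weight_le hM.1
    linarith
  linarith

open Classical in
/-- The number of ordered pairs of matched vertices in different parts. -/
noncomputable def cross (Γ : DirPMGame V (Fin 2)) (M : Γ.graph.Subgraph) : ℕ :=
  ∑ i, (Finset.univ.filter fun j => M.Adj i j ∧ Γ.part i ≠ Γ.part j).card

theorem cross_eq (M : Γ.graph.Subgraph) : Γ.cross M = 2 * (M.edgeSet ∩ Γ.crossing).ncard := by
  rw [← M.sum_card_adj_eq, cross]
  refine Finset.sum_congr rfl fun i _ => ?_
  congr 1
  ext j
  simp [mem_crossing]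

/-- With `f` the partner map, player `0` receives `1/2` or `2/3` for each `i` with `f i` in its
part, the larger value when `i` is in the other part. So the share is `1/2` per own vertex plus
`1/6` per crossing edge, and `cross` counts crossing edges twice. -/
theorem IsPerfect.utility_zero (h : Γ.IsPerfect) {M : Γ.graph.Subgraph}
    (hM : M.IsPerfectMatching) : 12 * Γ.utility M 0 = 6 * Γ.size + Γ.cross M := by
  classical
  obtain ⟨f, hf, hfM⟩ := hM.exists_involutive
  have hadj : ∀ i, Γ.graph.Adj i (f i) := fun i => M.adj_sub ((hfM i _).2 rfl)
  have hsum : ∀ g : V → ℚ, ∑ i, g (f i) = ∑ i, g i := fun g => Equiv.sum_comp hf.toPerm g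
  have h1 : Γ.utility M 0 = ∑ i, if Γ.part (f i) = 0 then Γ.w i (f i) else 0 := by
    simp only [utility, hfM, ite_and]
    simp
  have h2 : (Γ.cross M : ℚ) = ∑ i, if Γ.part i ≠ Γ.part (f i) then (1 : ℚ) else 0 := by
    simp only [cross, Finset.card_filter, hfM, ite_and]
    simp
  have h3 : (Γ.size : ℚ) = ∑ i, if Γ.part i = 0 then (1 : ℚ) else 0 := by
    simp [size]
  have h4 := hsum fun i => if Γ.part i = 0 then (1 : ℚ) else 0
  have h5 := hsum fun i => if Γ.part i = 0 ∧ Γ.part (f i) = 1 then (1 : ℚ) else 0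
  simp only [hf _] at h5
  rw [h1, h2, h3, ← h4, Finset.mul_sum, Finset.mul_sum]
  -- A crossing edge is seen from both ends; reindexing by the involution identifies the two
  -- contributions.
  have h6 : ∑ i, (if Γ.part i ≠ Γ.part (f i) then (1 : ℚ) else 0) =
      2 * ∑ i, if Γ.part (f i) = 0 ∧ Γ.part i = 1 then (1 : ℚ) else 0 := by
    rw [two_mul]
    conv_rhs => arg 2; rw [h5]
    rw [← Finset.sum_add_distrib]
    refine Finset.sum_congr rfl fun i _ => ?_
    rcases Γ.part_eq i with hi | hi <;> rcases Γ.part_eq (f i) with hj | hj <;> simp [hi, hj]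
  rw [h6, Finset.mul_sum, ← Finset.sum_add_distrib]
  refine Finset.sum_congr rfl fun i _ => ?_
  rw [h.w_eq (hadj i)]
  rcases Γ.part_eq i with hi | hi <;> rcases Γ.part_eq (f i) with hj | hj <;> norm_num [hi, hj]

/-- The shares add up to the sum of `w i (f i)`. Reversing all arcs by the involution leaves this
sum unchanged, and opposite arcs have total weight 1. -/
theorem IsPerfect.utility_add (h : Γ.IsPerfect) {M : Γ.graph.Subgraph}
    (hM : M.IsPerfectMatching) : 2 * (Γ.utility M 0 + Γ.utility M 1) = Fintype.card V := by
  classical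
  obtain ⟨f, hf, hfM⟩ := hM.exists_involutive
  have hadj : ∀ i, Γ.graph.Adj i (f i) := fun i => M.adj_sub ((hfM i _).2 rfl)
  have h1 : ∀ p, Γ.utility M p = ∑ i, if Γ.part (f i) = p then Γ.w i (f i) else 0 := by
    intro p
    simp only [utility, hfM, ite_and]
    simp
  have h2 : Γ.utility M 0 + Γ.utility M 1 = ∑ i, Γ.w i (f i) := by
    rw [h1, h1, ← Finset.sum_add_distrib]
    refine Finset.sum_congr rfl fun i _ => ?_
    rcases Γ.part_eq (f i) with hj | hj <;> simp [hj]
  have h3 : ∑ i, Γ.w (f i) i = ∑ i, Γ.w i (f i) := by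
    have := Equiv.sum_comp hf.toPerm fun i => Γ.w i (f i)
    simpa [hf _] using this
  rw [h2, two_mul]
  conv_lhs => arg 1; rw [← h3]
  rw [← Finset.sum_add_distrib, Finset.sum_congr rfl fun i _ => h.w_add_w (hadj i).symm]
  simp

/-- Target and shares both sum to half the number of vertices, so the deviations of the two players
are negatives of each other and player `0` alone decides. -/
theorem IsPerfect.maxDeviation_eq (h : Γ.IsPerfect) {x : Fin 2 → ℚ} (hx : Γ.IsAllocation x)
    {M : Γ.graph.Subgraph} (hM : M.IsPerfectMatching) :
    12 * Γ.maxDeviation x M = |12 * x 0 - 6 * Γ.size - Γ.cross M| := by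
  have h1 := h.utility_zero hM
  have h2 := h.utility_add hM
  have h3 := h.two_mul_value
  have h4 : x 0 + x 1 = Γ.value Set.univ := by simpa [IsAllocation] using hx
  have h5 : x 1 - Γ.utility M 1 = -(x 0 - Γ.utility M 0) := by linarith
  have h6 : Γ.maxDeviation x M = |x 0 - Γ.utility M 0| := by
    refine le_antisymm (Finset.sup'_le _ _ fun p _ => ?_)
      (Finset.le_sup' (fun p => |x p - Γ.utility M p|) (Finset.mem_univ 0))
    match p with
    | 0 => exact le_rfl
    | 1 => rw [h5, abs_neg]
  rw [h6, ← abs_of_pos (show (0 : ℚ) < 12 by norm_num), ← abs_mul,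
    abs_of_pos (show (0 : ℚ) < 12 by norm_num)]
  congr 1
  linarith

/-- Minimal matchings are the perfect matchings with the best number of crossing edges. -/
theorem IsPerfect.isMinimalMatching_iff (h : Γ.IsPerfect) {x : Fin 2 → ℚ} (hx : Γ.IsAllocation x)
    {M : Γ.graph.Subgraph} : Γ.IsMinimalMatching x M ↔ M.IsPerfectMatching ∧
      ∀ M' : Γ.graph.Subgraph, M'.IsPerfectMatching →
        |12 * x 0 - 6 * Γ.size - Γ.cross M| ≤ |12 * x 0 - 6 * Γ.size - Γ.cross M'| := by
  simp only [IsMinimalMatching, h.isMaxWeightMatching_iff]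
  refine and_congr_right fun hM => forall_congr' fun M' => forall_congr' fun hM' => ?_
  rw [← h.maxDeviation_eq hx hM, ← h.maxDeviation_eq hx hM']
  constructor <;> intro <;> linarith

end DirPMGame

/-! ### Encodings and lists -/

theorem List.ofFn_eq_map_range {α : Type} {n : ℕ} {f : Fin n → α} {g : ℕ → α}
    (h : ∀ i : Fin n, f i = g i) : List.ofFn f = (List.range n).map g := by
  rw [List.ofFn_eq_map, ← List.map_coe_finRange_eq_range, List.map_map]
  exact List.map_congr_left fun i _ => h i

/-- The equivalence `finProdFinEquiv` sends `(i, j)` to `j + n * i`, the row-major order in which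
nested list traversals produce their entries. -/
theorem List.ofFn_eq_flatMap_range {α : Type} {n : ℕ} {f : Fin (n * n) → α} {g : ℕ → ℕ → α}
    (h : ∀ i j : Fin n, f (finProdFinEquiv (i, j)) = g i j) :
    List.ofFn f = (List.range n).flatMap fun i => (List.range n).map fun j => g i j := by
  rw [List.ofFn_mul, List.flatMap_def]
  congr 1
  refine List.ofFn_eq_map_range fun i => List.ofFn_eq_map_range fun j => ?_
  rw [← h]
  congr 1
  ext
  simp [Nat.mul_comm, Nat.add_comm]

theorem List.length_filter_range (n : ℕ) (p : ℕ → Bool) :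
    ((List.range n).filter p).length = (Finset.univ.filter fun i : Fin n => p i = true).card := by
  rw [Finset.card_filter, Fin.sum_univ_eq_sum_range fun i => if p i = true then 1 else 0]
  induction n with
  | zero => simp
  | succ n ih =>
    rw [List.range_succ, List.filter_append, List.length_append, ih, Finset.sum_range_succ]
    cases h : p n <;> simp [h]

theorem List.length_flatMap_range {α : Type} (n : ℕ) (l : ℕ → List α) :
    ((List.range n).flatMap l).length = ∑ i : Fin n, (l i).length := by
  rw [Fin.sum_univ_eq_sum_range fun i => (l i).length]
  induction n with
  | zero => simp
  | succ n ih => simp [List.range_succ, Finset.sum_range_succ, ih]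

theorem List.getD_ofFn {α : Type} {n : ℕ} (f : Fin n → α) (i : Fin n) (d : α) :
    (List.ofFn f).getD i d = f i := by
  simp [List.getD_eq_getElem?_getD]

theorem Nat.getD_bits (n i : ℕ) : n.bits.getD i false = n.testBit i := by
  rw [Nat.testBit_eq_inth, List.getI_eq_getElem?_getD, List.getD_eq_getElem?_getD]
  rfl

theorem sameBits_iff {a b : ℕ} : sameBits a.bits b.bits = true ↔ a = b := by
  constructor
  · intro h
    simp only [sameBits, List.all_eq_true, List.mem_range, beq_iff_eq] at h
    refine Nat.eq_of_testBit_eq fun i => ?_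
    rcases lt_or_ge i (a.bits.length + b.bits.length) with hi | hi
    · simpa only [Nat.getD_bits] using h i hi
    · rw [← Nat.getD_bits, ← Nat.getD_bits, List.getD_eq_default _ _ (by omega),
        List.getD_eq_default _ _ (by omega)]
  · rintro rfl
    simp [sameBits]

theorem code_bits (n : ℕ) : code n.bits = Enc.nat n := rfl

theorem code_ofFn {α : Type} [TreeCode α] {n : ℕ} (f : Fin n → α) :
    code (List.ofFn f) = Enc.vector fun i => code (f i) := by
  simp only [code, Enc.vector, List.map_ofFn]
  rfl

theorem code_matrix {α : Type} [TreeCode α] {n : ℕ} (f : Fin n → Fin n → α) :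
    code (List.ofFn fun i => List.ofFn (f i)) = Enc.matrix fun i j => code (f i j) := by
  rw [code_ofFn]
  simp only [code_ofFn]
  rfl

open Classical in
theorem code_prop_matrix {n : ℕ} (P : Fin n → Fin n → Prop) :
    code (List.ofFn fun i => List.ofFn fun j => decide (P i j)) =
      Enc.matrix fun i j => Enc.prop (P i j) :=
  code_matrix _

theorem boolEntry_ofFn {n : ℕ} (f : Fin n → Fin n → Bool) (i j : Fin n) :
    boolEntry (List.ofFn fun i => List.ofFn (f i)) i j = f i j := by
  rw [boolEntry, List.getD_ofFn, List.getD_ofFn]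

theorem treeEntry_ofFn {n : ℕ} (f : Fin n → Fin n → DTree) (i j : Fin n) :
    treeEntry (List.ofFn fun i => List.ofFn (f i)) i j = f i j := by
  rw [treeEntry, List.getD_ofFn, List.getD_ofFn]

theorem answerEntry_matrix {n : ℕ} (P : Fin n → Fin n → Prop) (i j : Fin n) :
    answerEntry (Enc.matrix fun i j => Enc.prop (P i j)) i j = true ↔ P i j := by
  rw [answerEntry, Enc.matrix, Enc.vector, DTree.toList_list, List.getD_ofFn, Enc.vector,
    DTree.toList_list, List.getD_ofFn, Enc.prop, DTree.toBool_bool]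
  simp

/-- One of the truncated differences `a - b` and `b - a` vanishes, so their sum is the absolute
value of the numerator. Coprimality ensures that the reduced fraction has this numerator and
denominator. -/
theorem code_fractionBits {a b d : ℕ} (hd : 0 < d) (h : Nat.Coprime (a - b + (b - a)) d) :
    code (fractionBits a b d) = Enc.rat (((a : ℚ) - b) / d) := by
  have hz : ((a : ℤ) - b).natAbs = a - b + (b - a) := by omega
  have h1 : (((a : ℚ) - b) / d) = ((((a : ℤ) - b : ℤ) : ℚ) / ((d : ℤ) : ℚ)) := by push_cast; rfl
  have h2 : Nat.Coprime ((a : ℤ) - b).natAbs ((d : ℤ)).natAbs := by rwa [hz]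
  have h3 := Rat.num_div_eq_of_coprime (Int.natCast_pos.2 hd) h2
  have h4 := Rat.den_div_eq_of_coprime (Int.natCast_pos.2 hd) h2
  rw [Enc.rat, h1, h3, Nat.cast_injective h4, Enc.int, hz]
  have h5 : decide ((a : ℤ) - b < 0) = decide (a < b) := by
    rw [decide_eq_decide]
    omega
  rw [h5]
  rfl

/-! ### Perfect matchings as involutions -/

theorem SimpleGraph.Subgraph.sum_card_adj_of_involutive {V : Type} [Fintype V] {G : SimpleGraph V}
    {M : G.Subgraph} {f : V → V} (hf : ∀ i j, M.Adj i j ↔ f i = j) (P : V → V → Prop)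
    [∀ i, DecidablePred fun j => M.Adj i j ∧ P i j] [DecidablePred fun i => P i (f i)] :
    ∑ i, (Finset.univ.filter fun j => M.Adj i j ∧ P i j).card =
      (Finset.univ.filter fun i => P i (f i)).card := by
  classical
  rw [Finset.card_filter]
  refine Finset.sum_congr rfl fun i _ => ?_
  rw [Finset.card_filter, Finset.sum_congr rfl (g := fun j => if f i = j then
    if P i j then 1 else 0 else 0) fun j _ => by simp only [hf, ite_and]]
  simp

theorem SimpleGraph.exists_isPerfectMatching_of_involutive {V : Type} (G : SimpleGraph V)
    {f : V → V} (hf : Function.Involutive f) (hG : ∀ i, G.Adj i (f i)) :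
    ∃ M : G.Subgraph, M.IsPerfectMatching ∧ ∀ i j, M.Adj i j ↔ f i = j := by
  refine ⟨{ verts := Set.univ
            Adj := fun i j => f i = j
            adj_sub := fun {i j} h => h ▸ hG i
            edge_vert := fun _ => Set.mem_univ _
            symm := ⟨fun i j h => h ▸ hf i⟩ }, ?_, fun i j => Iff.rfl⟩
  rw [SimpleGraph.Subgraph.isPerfectMatching_iff]
  exact fun i => ⟨f i, rfl, fun j h => Eq.symm h⟩

/-- The cardinality modulo 2 is a sum of ones in `ZMod 2`, which cancels in pairs along an
involution without fixed points. -/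
theorem Finset.even_card_of_involutive {V : Type} [Fintype V] {f : V → V}
    (hf : Function.Involutive f) (hne : ∀ i, f i ≠ i) {P : V → Prop} [DecidablePred P] (hP : ∀ i, P i → P (f i)) :
    Even (Finset.univ.filter P).card := by
  rw [← ZMod.natCast_eq_zero_iff_even, Finset.cast_card]
  refine Finset.sum_involution (fun i _ => f i) ?_ (fun i _ _ => hne i) ?_ (fun i _ => hf i)
  · exact fun _ _ => by decide
  · intro i hi
    simpa using hP i (by simpa using hi)

open Classical in
-- Partner maps replace subgraphs here. Vertices with a red matching edge are counted instead of red
-- edges, which doubles `k`.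
theorem EPMInstance.isYes_iff (I : EPMInstance) : I.IsYes ↔
    ∃ f : Fin I.n → Fin I.n, Function.Involutive f ∧ (∀ i, I.graph.Adj i (f i)) ∧
      (Finset.univ.filter fun i => s(i, f i) ∈ I.red).card = 2 * I.k := by
  constructor
  · rintro ⟨M, hM, hk⟩
    obtain ⟨f, hf, hfM⟩ := hM.exists_involutive
    refine ⟨f, hf, fun i => M.adj_sub ((hfM i _).2 rfl), ?_⟩
    rw [← hk, ← M.sum_card_adj_eq,
      SimpleGraph.Subgraph.sum_card_adj_of_involutive hfM fun i j => s(i, j) ∈ I.red]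
  · rintro ⟨f, hf, hG, hk⟩
    obtain ⟨M, hM, hfM⟩ := I.graph.exists_isPerfectMatching_of_involutive hf hG
    refine ⟨M, hM, ?_⟩
    rw [← SimpleGraph.Subgraph.sum_card_adj_of_involutive hfM fun i j => s(i, j) ∈ I.red,
      M.sum_card_adj_eq] at hk
    omega

/-! ### The gadget game -/

namespace EPMInstance

/-- Adjacency in the gadget graph: the vertex `(i, i)` stands for `i`, and every edge `ij` is
replaced by the path through `(i, i)`, `(i, j)`, `(j, i)`, `(j, j)`. For pairs `ij` that are not
edges, only the edge between `(i, j)` and `(j, i)` is there. -/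
def GadgetAdj (I : EPMInstance) (u v : Fin I.n × Fin I.n) : Prop :=
  (u.1 ≠ u.2 ∧ v.1 = u.2 ∧ v.2 = u.1) ∨ (u.1 = u.2 ∧ v.1 = u.1 ∧ I.graph.Adj v.1 v.2) ∨
    (v.1 = v.2 ∧ u.1 = v.1 ∧ I.graph.Adj u.1 u.2)

theorem GadgetAdj.symm {I : EPMInstance} {u v : Fin I.n × Fin I.n} (h : I.GadgetAdj u v) :
    I.GadgetAdj v u := by
  rcases h with ⟨h1, h2, h3⟩ | ⟨h1, h2, h3⟩ | ⟨h1, h2, h3⟩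
  · exact .inl ⟨by rw [h2, h3]; exact h1.symm, h3.symm, h2.symm⟩
  · exact .inr (.inr ⟨h1, h2, h3⟩)
  · exact .inr (.inl ⟨h1, h2, h3⟩)

theorem not_gadgetAdj_self (I : EPMInstance) (u : Fin I.n × Fin I.n) : ¬ I.GadgetAdj u u := by
  rintro (⟨h1, h2, h3⟩ | ⟨h1, h2, h3⟩ | ⟨h1, h2, h3⟩)
  · exact h1 h2
  · exact I.graph.loopless.irrefl _ (h1 ▸ h3)
  · exact I.graph.loopless.irrefl _ (h1 ▸ h3)

theorem red_subset (I : EPMInstance) : I.red ⊆ I.graph.edgeSet :=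
  I.union_eq ▸ Set.subset_union_left

theorem not_mem_red_self (I : EPMInstance) (i : Fin I.n) : s(i, i) ∉ I.red := fun h =>
  I.graph.loopless.irrefl i (I.red_subset h)

open Classical in
/-- The part of a vertex of the gadget. -/
noncomputable def gadgetPart (I : EPMInstance) (u : Fin I.n × Fin I.n) : Fin 2 :=
  if s(u.1, u.2) ∈ I.red then 1 else 0

open Classical in
/-- The gadget game. -/
noncomputable def gadgetGame (I : EPMInstance) : DirPMGame (Fin (I.n * I.n)) (Fin 2) where
  arcs := ⟨fun a b => I.GadgetAdj (finProdFinEquiv.symm a) (finProdFinEquiv.symm b)⟩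
  loopless a := I.not_gadgetAdj_self _
  w a b := if I.GadgetAdj (finProdFinEquiv.symm a) (finProdFinEquiv.symm b) then
      if I.gadgetPart (finProdFinEquiv.symm a) = I.gadgetPart (finProdFinEquiv.symm b) then 1 / 2
      else if I.gadgetPart (finProdFinEquiv.symm a) = 1 then 2 / 3 else 1 / 3
    else 0
  w_pos a b h := by
    have h' : I.GadgetAdj (finProdFinEquiv.symm a) (finProdFinEquiv.symm b) := h
    rw [if_pos h']
    split_ifs <;> norm_num
  w_zero a b h := if_neg h
  part a := I.gadgetPart (finProdFinEquiv.symm a)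

theorem gadgetGame_adj {I : EPMInstance} {a b : Fin (I.n * I.n)} : I.gadgetGame.graph.Adj a b ↔
    I.GadgetAdj (finProdFinEquiv.symm a) (finProdFinEquiv.symm b) :=
  ⟨fun h => h.1, fun h => ⟨h, h.symm⟩⟩

theorem gadgetGame_sparse (I : EPMInstance) : I.gadgetGame.IsSparse 3 := by
  have : {r : ℚ | ∃ i j, I.gadgetGame.arcs.Adj i j ∧ I.gadgetGame.w i j = r} ⊆
      {1 / 2, 2 / 3, 1 / 3} := by
    rintro r ⟨a, b, hab, rfl⟩
    have h' : I.GadgetAdj (finProdFinEquiv.symm a) (finProdFinEquiv.symm b) := hab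
    simp only [gadgetGame, if_pos h']
    split_ifs <;> simp
  refine (Set.encard_le_encard this).trans ?_
  refine (Set.encard_insert_le _ _).trans ?_
  refine (add_le_add_left (Set.encard_insert_le _ _) 1).trans ?_
  rw [Set.encard_singleton]
  norm_num

/-- The matching of the gadget that corresponds to the matching `f`. -/
def gadgetPartner {n : ℕ} (f : Fin n → Fin n) (u : Fin n × Fin n) : Fin n × Fin n :=
  if u.2 = u.1 then (u.1, f u.1) else if u.2 = f u.1 then (u.1, u.1) else (u.2, u.1)

/-! ### Perfect matchings of the gadget -/

section

variable {I : EPMInstance} {f : Fin I.n → Fin I.n}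

theorem gadgetPartner_involutive (hf : Function.Involutive f) (hG : ∀ i, I.graph.Adj i (f i)) :
    Function.Involutive (gadgetPartner f) := by
  have hne : ∀ i, f i ≠ i := fun i => (hG i).ne'
  rintro ⟨i, j⟩
  by_cases h1 : j = i
  · subst h1
    simp [gadgetPartner, hne]
  · by_cases h2 : j = f i
    · subst h2
      simp [gadgetPartner, hne]
    · have h3 : i ≠ f j := fun h => h2 (by rw [h, hf])
      simp [gadgetPartner, h1, h2, h3, Ne.symm h1]

theorem gadgetAdj_gadgetPartner (hG : ∀ i, I.graph.Adj i (f i)) (u : Fin I.n × Fin I.n) :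
    I.GadgetAdj u (gadgetPartner f u) := by
  obtain ⟨i, j⟩ := u
  by_cases h1 : j = i
  · subst h1
    simp [gadgetPartner, GadgetAdj, hG]
  · by_cases h2 : j = f i
    · subst h2
      simp [gadgetPartner, GadgetAdj, hG, (hG i).ne', (hG i).ne]
    · simp [gadgetPartner, GadgetAdj, h1, h2, Ne.symm h1]

/-- The matching `f` supplies the perfect matching demanded of a perfect game. Its number of red
edges is irrelevant here. -/
theorem gadgetGame_perfect (hf : Function.Involutive f) (hG : ∀ i, I.graph.Adj i (f i)) :
    I.gadgetGame.IsPerfect := by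
  refine ⟨fun a b hab ha hb => ?_, fun a b hab hp => ?_, ?_⟩
  · have ha' : I.gadgetPart (finProdFinEquiv.symm a) = 0 := ha
    have hb' : I.gadgetPart (finProdFinEquiv.symm b) = 1 := hb
    have h := gadgetGame_adj.1 hab
    simp [gadgetGame, h, h.symm, ha', hb', -finProdFinEquiv_symm_apply]
  · have hp' : I.gadgetPart (finProdFinEquiv.symm a) = I.gadgetPart (finProdFinEquiv.symm b) := hp
    simp [gadgetGame, gadgetGame_adj.1 hab, hp', -finProdFinEquiv_symm_apply]
  · obtain ⟨M, hM, -⟩ := I.gadgetGame.graph.exists_isPerfectMatching_of_involutive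
      (f := fun a => finProdFinEquiv (gadgetPartner f (finProdFinEquiv.symm a)))
      (fun a => by simp [gadgetPartner_involutive hf hG _, -finProdFinEquiv_symm_apply])
      (fun a => by simpa [gadgetGame_adj] using gadgetAdj_gadgetPartner hG _)
    exact ⟨M, hM⟩

/-- Every perfect matching of the gadget comes from a matching of the original graph. -/
theorem exists_eq_gadgetPartner {h : Fin I.n × Fin I.n → Fin I.n × Fin I.n}
    (hh : Function.Involutive h) (hG : ∀ u, I.GadgetAdj u (h u)) :
    ∃ f : Fin I.n → Fin I.n, Function.Involutive f ∧ (∀ i, I.graph.Adj i (f i)) ∧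
      h = gadgetPartner f := by
  -- The neighbours of `(i, i)` are the vertices `(i, j)` with `ij` an edge; the second coordinate
  -- of its partner will be `f i`.
  have h1 : ∀ i, (h (i, i)).1 = i ∧ I.graph.Adj i (h (i, i)).2 := by
    intro i
    rcases hG (i, i) with ⟨k1, k2, k3⟩ | ⟨k1, k2, k3⟩ | ⟨k1, k2, k3⟩
    · exact absurd rfl k1
    · exact ⟨k2, by rwa [k2] at k3⟩
    · exact absurd k3 (I.graph.loopless.irrefl _)
  have h2 : ∀ i j, i ≠ j → h (i, j) = (j, i) ∨ (h (i, j) = (i, i) ∧ I.graph.Adj i j) := by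
    intro i j hij
    rcases hG (i, j) with ⟨k1, k2, k3⟩ | ⟨k1, k2, k3⟩ | ⟨k1, k2, k3⟩
    · exact .inl (Prod.ext k2 k3)
    · exact absurd k1 hij
    · exact .inr ⟨Prod.ext k2.symm (k1.symm.trans k2.symm), k3⟩
  let f : Fin I.n → Fin I.n := fun i => (h (i, i)).2
  have hf : ∀ i, h (i, i) = (i, f i) := fun i => Prod.ext (h1 i).1 rfl
  have hadj : ∀ i, I.graph.Adj i (f i) := fun i => (h1 i).2
  have h3 : ∀ i j, i ≠ j → (h (i, j) = (i, i) ↔ j = f i) := by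
    intro i j hij
    constructor
    · intro hk
      have := hh (i, j)
      rw [hk, hf] at this
      exact (congrArg Prod.snd this).symm
    · rintro rfl
      rw [← hf, hh]
  refine ⟨f, fun i => ?_, hadj, ?_⟩
  · have k1 : h (i, f i) = (i, i) := (h3 _ _ (hadj i).ne).2 rfl
    -- If `(f i, i)` were matched along the middle of the path, its partner would be `(i, f i)`,
    -- which is already matched with `(i, i)`. So `(f i, i)` is matched with `(f i, f i)`, that is,
    -- `f (f i) = i`.
    rcases h2 (f i) i (hadj i).ne' with k2 | k2
    · have := hh (f i, i)
      rw [k2, k1] at this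
      exact absurd (congrArg Prod.fst this) (hadj i).ne
    · exact ((h3 _ _ (hadj i).ne').1 k2.1).symm
  · funext u
    obtain ⟨i, j⟩ := u
    by_cases k1 : j = i
    · subst k1
      simp [gadgetPartner, hf]
    · by_cases k2 : j = f i
      · have := (h3 i j (Ne.symm k1)).2 k2
        rw [this, gadgetPartner, if_neg k1, if_pos k2]
      · rcases h2 i j (Ne.symm k1) with k3 | k3
        · simp [gadgetPartner, k1, k2, k3]
        · exact absurd ((h3 i j (Ne.symm k1)).1 k3.1) k2

/-- Diagonal vertices belong to player `0`, and `(i, j)` and `(j, i)` have the same owner. So only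
the pairs `(i, i)`, `(i, f i)` with a red edge between `i` and `f i` cross, giving two vertices for
each such `i`. -/
theorem card_gadgetPartner (hG : ∀ i, I.graph.Adj i (f i))
    [DecidablePred fun i => s(i, f i) ∈ I.red] :
    (Finset.univ.filter fun u => I.gadgetPart u ≠ I.gadgetPart (gadgetPartner f u)).card =
      2 * (Finset.univ.filter fun i => s(i, f i) ∈ I.red).card := by
  classical
  rw [Finset.card_filter, Fintype.sum_prod_type, Finset.card_filter, Finset.mul_sum]
  refine Finset.sum_congr rfl fun i _ => ?_
  have h1 : ∀ j, (if I.gadgetPart (i, j) ≠ I.gadgetPart (gadgetPartner f (i, j)) then 1 else 0) =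
      (if j = i then if s(i, f i) ∈ I.red then 1 else 0 else 0) +
      (if j = f i then if s(i, f i) ∈ I.red then 1 else 0 else 0) := by
    intro j
    by_cases k1 : j = i
    · subst k1
      by_cases k2 : s(j, f j) ∈ I.red <;>
        simp [gadgetPartner, gadgetPart, I.not_mem_red_self, (hG j).ne, k2]
    · by_cases k2 : j = f i
      · subst k2
        by_cases k3 : s(i, f i) ∈ I.red <;>
          simp [gadgetPartner, gadgetPart, I.not_mem_red_self, (hG i).ne', k3]
      · have k4 : s(j, i) = s(i, j) := Sym2.eq_swap
        simp [gadgetPartner, gadgetPart, k1, k2, k4]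
  rw [Finset.sum_congr rfl fun j _ => h1 j, Finset.sum_add_distrib]
  by_cases k : s(i, f i) ∈ I.red <;> simp [k]

theorem cross_gadgetGame {M : I.gadgetGame.graph.Subgraph} (hG : ∀ i, I.graph.Adj i (f i))
    (hM : ∀ a b, M.Adj a b ↔ finProdFinEquiv (gadgetPartner f (finProdFinEquiv.symm a)) = b)
    [DecidablePred fun i => s(i, f i) ∈ I.red] :
    I.gadgetGame.cross M = 2 * (Finset.univ.filter fun i => s(i, f i) ∈ I.red).card := by
  classical
  rw [DirPMGame.cross, SimpleGraph.Subgraph.sum_card_adj_of_involutive hM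
    fun a b => I.gadgetGame.part a ≠ I.gadgetGame.part b]
  have := card_gadgetPartner hG
  rw [← Finset.card_map (finProdFinEquiv (m := I.n) (n := I.n)).toEmbedding] at this
  convert this using 2
  ext a
  simp only [Finset.mem_filter, Finset.mem_univ, true_and, Finset.mem_map_equiv, gadgetGame,
    Equiv.symm_apply_apply]

/-- Every perfect matching of the gadget game comes from a matching of the original graph. -/
theorem exists_of_isPerfectMatching {M : I.gadgetGame.graph.Subgraph} (hM : M.IsPerfectMatching) :
    ∃ f : Fin I.n → Fin I.n, Function.Involutive f ∧ (∀ i, I.graph.Adj i (f i)) ∧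
      ∀ a b, M.Adj a b ↔ finProdFinEquiv (gadgetPartner f (finProdFinEquiv.symm a)) = b := by
  obtain ⟨h, hh, hM⟩ := hM.exists_involutive
  obtain ⟨f, hf, hG, hfh⟩ := exists_eq_gadgetPartner (I := I)
    (h := fun u => finProdFinEquiv.symm (h (finProdFinEquiv u)))
    (fun u => by simp [hh _, -finProdFinEquiv_symm_apply]) (fun u => by
      have := gadgetGame_adj.1 (M.adj_sub ((hM (finProdFinEquiv u) _).2 rfl))
      simpa using this)
  refine ⟨f, hf, hG, fun a b => ?_⟩
  rw [hM, ← hfh]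
  simp [-finProdFinEquiv_symm_apply]

open Classical in
-- Swapping `(i, j)` with `(j, i)` off the diagonal and applying `f` on the diagonal preserves the
-- parts and has no fixed points. Evenness is what puts the target fractions in lowest terms.
theorem even_card_gadgetPart (hf : Function.Involutive f) (hG : ∀ i, I.graph.Adj i (f i))
    (p : Fin 2) : Even (Finset.univ.filter fun u => I.gadgetPart u = p).card := by
  refine Finset.even_card_of_involutive
    (f := fun u : Fin I.n × Fin I.n => if u.1 = u.2 then (f u.1, f u.1) else (u.2, u.1)) ?_ ?_ ?_
  · rintro ⟨i, j⟩
    by_cases h : i = j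
    · simp [h, hf _]
    · simp [h, Ne.symm h]
  · rintro ⟨i, j⟩
    by_cases h : i = j
    · simp [h, (hG j).ne']
    · simp [h, Ne.symm h]
  · rintro ⟨i, j⟩ hp
    by_cases h : i = j
    · subst h
      simpa [gadgetPart, I.not_mem_red_self] using hp
    · have k4 : s(j, i) = s(i, j) := Sym2.eq_swap
      simpa [gadgetPart, h, k4] using hp

end

end EPMInstance

/-! ### Reduction of Exact Perfect Matching to minimal matchings -/

theorem List.length_filter_ofFn {α : Type} {n : ℕ} (g : Fin n → α) (p : α → Bool) :
    ((List.ofFn g).filter p).length = (Finset.univ.filter fun i => p (g i) = true).card := by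
  rw [List.ofFn_eq_map, List.filter_map, List.length_map, Fin.univ_def, Finset.card_def,
    Finset.filter_val, Multiset.filter_coe, Multiset.coe_card]
  simp [Function.comp_def]

/-! ### Encoding of the gadget, choice of the target, and verification of answers -/

namespace EPMInstance

open Classical in
/-- The matrix of the red edges. -/
noncomputable def redMatrix (I : EPMInstance) : List (List Bool) :=
  List.ofFn fun i => List.ofFn fun j => decide (s(i, j) ∈ I.red)

open Classical in
/-- The matrix of the blue edges. -/
noncomputable def blueMatrix (I : EPMInstance) : List (List Bool) :=
  List.ofFn fun i => List.ofFn fun j => decide (s(i, j) ∈ I.blue)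

variable (I : EPMInstance)

theorem enc_eq : I.enc = code (I.redMatrix, I.blueMatrix, I.k.bits) := by
  rw [EPMInstance.enc, ← code_prop_matrix, ← code_prop_matrix, ← code_bits]
  rfl

theorem length_redMatrix : I.redMatrix.length = I.n := by simp [redMatrix]

theorem boolEntry_redMatrix (i j : Fin I.n) :
    boolEntry I.redMatrix i j = true ↔ s(i, j) ∈ I.red := by
  rw [redMatrix, boolEntry_ofFn]
  simp

theorem isEdge_iff (i j : Fin I.n) :
    isEdge I.redMatrix I.blueMatrix i j = true ↔ I.graph.Adj i j := by
  rw [isEdge, Bool.or_eq_true, boolEntry_redMatrix, blueMatrix, boolEntry_ofFn,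
    ← SimpleGraph.mem_edgeSet, ← I.union_eq, Set.mem_union]
  simp

theorem gadgetArc_iff (i j k l : Fin I.n) :
    gadgetArc I.redMatrix I.blueMatrix i j k l = true ↔ I.GadgetAdj (i, j) (k, l) := by
  simp only [gadgetArc, GadgetAdj, Bool.or_eq_true, Bool.and_eq_true, isEdge_iff,
    Bool.not_eq_true', decide_eq_true_eq, decide_eq_false_iff_not, Fin.val_inj, ne_eq]

theorem boolEntry_redMatrix_eq (i j : Fin I.n) :
    boolEntry I.redMatrix i j = decide (I.gadgetPart (i, j) = 1) := by
  rw [Bool.eq_iff_iff, boolEntry_redMatrix]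
  by_cases h : s(i, j) ∈ I.red <;> simp [gadgetPart, h]

theorem gadgetWeight_eq (i j k l : Fin I.n) :
    gadgetWeight I.redMatrix I.blueMatrix i j k l =
      Enc.rat (I.gadgetGame.w (finProdFinEquiv (i, j)) (finProdFinEquiv (k, l))) := by
  have h := I.gadgetArc_iff i j k l
  simp only [gadgetWeight, gadgetGame, Equiv.symm_apply_apply, boolEntry_redMatrix_eq, ← h]
  cases gadgetArc I.redMatrix I.blueMatrix i j k l with
  | false => rfl
  | true =>
    have h1 : ∀ u, I.gadgetPart u = 0 ∨ I.gadgetPart u = 1 := fun u => by omega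
    rcases h1 (i, j) with h2 | h2 <;> rcases h1 (k, l) with h3 | h3 <;> simp [h2, h3]

theorem code_gadgetMatrix : code (gadgetMatrix I.redMatrix I.blueMatrix) =
    Enc.matrix fun a b => Enc.rat (I.gadgetGame.w a b) := by
  have h := code_matrix fun a b => Enc.rat (I.gadgetGame.w a b)
  refine Eq.trans (congrArg code ?_) h
  rw [gadgetMatrix, length_redMatrix]
  refine (List.ofFn_eq_flatMap_range fun i j => ?_).symm
  rw [gadgetRow, length_redMatrix]
  exact List.ofFn_eq_flatMap_range fun k l => (I.gadgetWeight_eq i j k l).symm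

theorem gadgetParts_eq : gadgetParts I.redMatrix =
    List.ofFn fun a => decide (I.gadgetGame.part a = 1) := by
  rw [gadgetParts, length_redMatrix]
  refine (List.ofFn_eq_flatMap_range fun i j => ?_).symm
  rw [boolEntry_redMatrix_eq]
  simp only [gadgetGame, Equiv.symm_apply_apply]

open Classical in
/-- The number of vertices of the gadget in a part. -/
noncomputable def partSize (p : Fin 2) : ℕ := (Finset.univ.filter fun u => I.gadgetPart u = p).card

theorem card_part (p : Fin 2) :
    (Finset.univ.filter fun a => I.gadgetGame.part a = p).card = I.partSize p := by
  classical
  rw [partSize, ← Finset.card_map (finProdFinEquiv (m := I.n) (n := I.n)).toEmbedding]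
  congr 1
  ext a
  simp only [Finset.mem_filter, Finset.mem_univ, true_and, Finset.mem_map_equiv]
  rfl

theorem countBool_gadgetParts (b : Bool) :
    countBool b (gadgetParts I.redMatrix) = I.partSize (if b then 1 else 0) := by
  rw [countBool, gadgetParts_eq, List.length_filter_ofFn, ← card_part]
  congr 1
  ext a
  have := I.gadgetGame.part_eq a
  rcases this with h | h <;> cases b <;> simp [h]

theorem partSize_add : I.partSize 0 + I.partSize 1 = I.n * I.n := by
  classical
  have h := Finset.card_filter_add_card_filter_not (s := Finset.univ) (fun u => I.gadgetPart u = 0)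
  have h1 : ∀ u, ¬ I.gadgetPart u = 0 ↔ I.gadgetPart u = 1 := fun u => by omega
  simp only [h1] at h
  simpa [partSize] using h

/-- The gadget game with the target for `k` red edges. -/
noncomputable def gadgetTarget {f : Fin I.n → Fin I.n} (hf : Function.Involutive f)
    (hG : ∀ i, I.graph.Adj i (f i)) : PerfectGameInstance where
  n := I.n * I.n
  game := I.gadgetGame
  sparse := I.gadgetGame_sparse
  perfect := gadgetGame_perfect hf hG
  -- A matching with `k` red edges gives player `0` the share `s / 2 + k / 3`, where `s` is the size
  -- of that part. The target is `1/18` less: far below the spacing `1/3` of the shares, so `k`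
  -- remains the unique best number, while the fraction becomes reduced with denominator 18 for
  -- every `k`.
  x := ![(((9 * I.partSize 0 + 6 * I.k : ℕ) : ℚ) - (1 : ℕ)) / (18 : ℕ),
    (((9 * I.partSize 1 + 1 : ℕ) : ℚ) - (6 * I.k : ℕ)) / (18 : ℕ)]
  alloc := by
    have h := (gadgetGame_perfect hf hG).two_mul_value
    have h1 : (I.partSize 0 : ℚ) + I.partSize 1 = I.n * I.n := by exact_mod_cast I.partSize_add
    simp only [DirPMGame.IsAllocation, Fin.sum_univ_two, Matrix.cons_val_zero, Matrix.cons_val_one]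
    rw [Fintype.card_fin] at h
    push_cast at h ⊢
    linarith

theorem coprime_eighteen {m : ℕ} (h2 : ¬ 2 ∣ m) (h3 : ¬ 3 ∣ m) : m.Coprime 18 := by
  have k2 := ((Nat.Prime.coprime_iff_not_dvd Nat.prime_two).2 h2).symm
  have k3 := ((Nat.Prime.coprime_iff_not_dvd Nat.prime_three).2 h3).symm
  exact (k2.mul_right k3).mul_right k3

theorem gadgetTarget_enc {f : Fin I.n → Fin I.n} (hf : Function.Involutive f)
    (hG : ∀ i, I.graph.Adj i (f i)) :
    (I.gadgetTarget hf hG).enc = gadgetInstance I.redMatrix I.blueMatrix I.k := by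
  -- Even part sizes make both numerators odd, and the terms `±1` keep them prime to 3. Hence both
  -- fractions over 18 are in lowest terms and no gcd has to be computed.
  obtain ⟨s, hs⟩ := even_card_gadgetPart hf hG 0
  obtain ⟨t, ht⟩ := even_card_gadgetPart hf hG 1
  have hs' : I.partSize 0 = s + s := hs
  have ht' : I.partSize 1 = t + t := ht
  have h0 := code_fractionBits (a := 9 * I.partSize 0 + 6 * I.k) (b := 1) (d := 18) (by norm_num)
    (coprime_eighteen (by omega) (by omega))
  have h1 := code_fractionBits (a := 9 * I.partSize 1 + 1) (b := 6 * I.k) (d := 18) (by norm_num)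
    (coprime_eighteen (by omega) (by omega))
  have h2 : Enc.vector (fun a => Enc.bool (decide (I.gadgetGame.part a = 1))) =
      code (gadgetParts I.redMatrix) := by
    rw [gadgetParts_eq, code_ofFn]
    rfl
  change DTree.cons (Enc.matrix fun a b => Enc.rat (I.gadgetGame.w a b))
    (DTree.cons (Enc.vector fun a => Enc.bool (decide (I.gadgetGame.part a = 1)))
      (DTree.cons (Enc.rat ((((9 * I.partSize 0 + 6 * I.k : ℕ) : ℚ) - (1 : ℕ)) / (18 : ℕ)))
        (Enc.rat ((((9 * I.partSize 1 + 1 : ℕ) : ℚ) - (6 * I.k : ℕ)) / (18 : ℕ))))) = _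
  rw [← h0, ← h1, h2, ← code_gadgetMatrix, gadgetInstance, countBool_gadgetParts,
    countBool_gadgetParts]
  rfl

theorem readOff_iff (y : DTree) (i j : Fin I.n) :
    readOff I.redMatrix I.blueMatrix y i j = true ↔
      answerEntry y (finProdFinEquiv (i, i)) (finProdFinEquiv (i, j)) = true ∧
      answerEntry y (finProdFinEquiv (j, j)) (finProdFinEquiv (j, i)) = true ∧
      I.graph.Adj i j := by
  rw [readOff, Bool.and_eq_true, Bool.and_eq_true, isEdge_iff, length_redMatrix]
  simp only [finProdFinEquiv_apply_val, Nat.add_comm]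

theorem verify_iff (y : DTree) (k : ℕ) [∀ i j : Fin I.n, Decidable (s(i, j) ∈ I.red)] :
    verify I.redMatrix I.blueMatrix y k = true ↔
      (∀ i : Fin I.n, (Finset.univ.filter fun j : Fin I.n =>
        readOff I.redMatrix I.blueMatrix y i j = true).card = 1) ∧
      ∑ i : Fin I.n, (Finset.univ.filter fun j : Fin I.n =>
        readOff I.redMatrix I.blueMatrix y i j = true ∧ s(i, j) ∈ I.red).card = 2 * k := by
  rw [verify, Bool.and_eq_true, List.all_eq_true, decide_eq_true_eq, List.length_flatMap_range,
    length_redMatrix, two_mul]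
  simp only [List.length_filter_range, decide_eq_true_eq, List.mem_range, Bool.and_eq_true,
    boolEntry_redMatrix]
  exact and_congr_left fun _ => ⟨fun h i => h i i.2, fun h i hi => h ⟨i, hi⟩⟩

/-- No hypothesis on `y` is needed: `readOff` is symmetric and contains only edges, so unique
partners define an involution along edges. The count runs over ordered pairs, which accounts for `2
* k`. -/
theorem isYes_of_verify {y : DTree} (h : verify I.redMatrix I.blueMatrix y I.k = true) :
    I.IsYes := by
  classical
  rw [verify_iff] at h
  obtain ⟨h1, h2⟩ := h
  simp only [Finset.card_eq_one, Finset.ext_iff, Finset.mem_filter, Finset.mem_univ, true_and,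
    Finset.mem_singleton] at h1
  choose f hf using h1
  have hsymm : ∀ i j : Fin I.n, readOff I.redMatrix I.blueMatrix y i j = true →
      readOff I.redMatrix I.blueMatrix y j i = true := by
    intro i j h
    rw [readOff_iff] at h ⊢
    exact ⟨h.2.1, h.1, h.2.2.symm⟩
  refine I.isYes_iff.2 ⟨f, fun i => ?_, fun i => ?_, ?_⟩
  · exact ((hf _ _).1 (hsymm _ _ ((hf i _).2 rfl))).symm
  · exact ((I.readOff_iff y i _).1 ((hf i _).2 rfl)).2.2
  · rw [← h2, Finset.card_filter]
    refine Finset.sum_congr rfl fun i _ => ?_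
    rw [Finset.card_filter]
    simp only [hf, ite_and]
    simp

/-- A solution `f₀` makes the gadget game a legitimate instance and gives a matching at distance
`2/3` from the scaled target. The oracle's matching is at least as close, which forces the same
number of red edges, and `readOff` recovers it exactly. -/
theorem verify_of_isYes {O : DTree → DTree} (hO : MinimalMatchingPerfectGame.SolvedBy O)
    (h : I.IsYes) : verify I.redMatrix I.blueMatrix
      (O (gadgetInstance I.redMatrix I.blueMatrix I.k)) I.k = true := by
  classical
  obtain ⟨f₀, hf₀, hG₀, hk₀⟩ := I.isYes_iff.1 h
  obtain ⟨M, hM, hy⟩ : ∃ M : I.gadgetGame.graph.Subgraph,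
      I.gadgetGame.IsMinimalMatching (I.gadgetTarget hf₀ hG₀).x M ∧
      O (I.gadgetTarget hf₀ hG₀).enc = Enc.matrix fun i j => Enc.prop (M.Adj i j) :=
    hO (I.gadgetTarget hf₀ hG₀)
  rw [gadgetTarget_enc] at hy
  have hperf := gadgetGame_perfect hf₀ hG₀
  have halloc : I.gadgetGame.IsAllocation (I.gadgetTarget hf₀ hG₀).x :=
    (I.gadgetTarget hf₀ hG₀).alloc
  obtain ⟨hMp, hmin⟩ := (hperf.isMinimalMatching_iff halloc).1 hM
  obtain ⟨M₀, hM₀p, hM₀⟩ := I.gadgetGame.graph.exists_isPerfectMatching_of_involutive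
    (f := fun a => finProdFinEquiv (gadgetPartner f₀ (finProdFinEquiv.symm a)))
    (fun a => by simp [gadgetPartner_involutive hf₀ hG₀ _, -finProdFinEquiv_symm_apply])
    (fun a => by simpa [gadgetGame_adj] using gadgetAdj_gadgetPartner hG₀ _)
  have h1 := hmin M₀ hM₀p
  obtain ⟨f, hf, hG, hMf⟩ := exists_of_isPerfectMatching hMp
  have h2 : I.gadgetGame.cross M₀ = 4 * I.k := by
    rw [cross_gadgetGame hG₀ hM₀, hk₀]
    ring
  have h3 : I.gadgetGame.cross M = _ := cross_gadgetGame hG hMf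
  have h4 : (I.gadgetTarget hf₀ hG₀).x 0 =
    (((9 * I.partSize 0 + 6 * I.k : ℕ) : ℚ) - (1 : ℕ)) / (18 : ℕ) := rfl
  have h5 : I.gadgetGame.size = I.partSize 0 := by
    rw [← card_part, DirPMGame.size]
  -- After scaling by 12 and subtracting the part size, the target is `4 * k - 2/3`, while the
  -- matching contributes `2 * c` for an integer `c`. A distance of at most `2/3` leaves only `c = 2
  -- * k`.
  have hcard : (Finset.univ.filter fun i => s(i, f i) ∈ I.red).card = 2 * I.k := by
    have h6 : |4 * (I.k : ℚ) - 2 / 3 - (I.gadgetGame.cross M : ℚ)| ≤ 2 / 3 := by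
      refine le_trans (le_of_eq ?_) (h1.trans (le_of_eq ?_))
      · congr 1
        rw [h4, h5]
        push_cast
        ring
      · have h7 : |(-(2 / 3) : ℚ)| = 2 / 3 := by norm_num
        rw [h4, h5, h2, ← h7]
        congr 1
        push_cast
        ring
    rw [h3] at h6
    generalize (Finset.univ.filter fun i => s(i, f i) ∈ I.red).card = c at h6
    rw [abs_le] at h6
    push_cast at h6
    have h7 : (c : ℚ) < 2 * I.k + 1 := by linarith
    have h8 : (2 * I.k : ℚ) < c + 1 := by linarith
    have h9 : c < 2 * I.k + 1 := by exact_mod_cast h7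
    have h10 : 2 * I.k < c + 1 := by exact_mod_cast h8
    omega
  have hread : ∀ i j : Fin I.n, readOff I.redMatrix I.blueMatrix
      (O (gadgetInstance I.redMatrix I.blueMatrix I.k)) i j = true ↔ j = f i := by
    intro i j
    rw [hy, readOff_iff, answerEntry_matrix M.Adj, answerEntry_matrix M.Adj, hMf, hMf]
    simp only [Equiv.symm_apply_apply, gadgetPartner, if_true, EmbeddingLike.apply_eq_iff_eq,
      Prod.mk.injEq, true_and]
    constructor
    · rintro ⟨h, -⟩
      exact h.symm
    · rintro rfl
      exact ⟨rfl, hf i, hG i⟩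
  rw [verify_iff]
  simp only [hread]
  refine ⟨fun i => Finset.card_eq_one.2 ⟨f i, by ext j; simp⟩, ?_⟩
  rw [← hcard, Finset.card_filter]
  refine Finset.sum_congr rfl fun i _ => ?_
  by_cases k : s(i, f i) ∈ I.red
  · rw [if_pos k, Finset.card_eq_one]
    refine ⟨f i, ?_⟩
    ext j
    simp only [Finset.mem_filter, Finset.mem_univ, true_and, Finset.mem_singleton,
      and_iff_left_iff_imp]
    rintro rfl
    exact k
  · rw [if_neg k, Finset.card_eq_zero, Finset.filter_eq_empty_iff]
    rintro j - ⟨rfl, h⟩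
    exact k h

theorem IsYes.k_le {I : EPMInstance} (h : I.IsYes) : I.k ≤ I.n := by
  classical
  obtain ⟨f, -, -, hk⟩ := I.isYes_iff.1 h
  have := (Finset.univ.filter fun i => s(i, f i) ∈ I.red).card_le_univ
  rw [Fintype.card_fin] at this
  omega

/-- The number `k` is binary and may be exponentially large, so the algorithm tries the unary
candidates `m ≤ n` and compares binary digits. By `IsYes.k_le` no solvable instance is missed. -/
theorem solveMatching_iff {O : DTree → DTree} (hO : MinimalMatchingPerfectGame.SolvedBy O) :
    solveMatching O I.redMatrix I.blueMatrix I.k.bits = true ↔ I.IsYes := by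
  rw [solveMatching, List.any_eq_true]
  constructor
  · rintro ⟨m, -, hm⟩
    rw [Bool.and_eq_true, sameBits_iff] at hm
    obtain ⟨rfl, h⟩ := hm
    exact I.isYes_of_verify h
  · intro h
    refine ⟨I.k, ?_, ?_⟩
    · rw [List.mem_range, length_redMatrix]
      exact Nat.lt_succ_of_le h.k_le
    · rw [Bool.and_eq_true, sameBits_iff]
      exact ⟨rfl, I.verify_of_isYes hO h⟩

end EPMInstance

/-- A problem that is solved by a polynomial-time function with an oracle is reducible. -/
theorem PolyTime.polyReducible {A B : CompProblem} {α β : Type} [TreeCode α] [TreeCode β]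
    {F : (DTree → DTree) → α → β} (hF : PolyTime F) (input : A.Inst → α)
    (henc : ∀ I, A.enc I = code (input I))
    (hcorrect : ∀ O, B.SolvedBy O → ∀ I, A.Correct I (code (F O (input I)))) :
    PolyReducible A B := by
  obtain ⟨P, hP⟩ := hF
  refine ⟨P, fun q => ?_⟩
  obtain ⟨p, hp⟩ := hP q
  refine ⟨p, fun O hO hq I => ?_⟩
  obtain ⟨t, h1, h2⟩ := hp O hq (input I)
  rw [henc]
  exact ⟨_, t, h1, hcorrect O hO I, h2⟩

theorem exactPerfectMatching_polyReducible :
    PolyReducible ExactPerfectMatching MinimalMatchingPerfectGame := by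
  refine PolyTime.solveMatching.polyReducible (fun I => (I.redMatrix, I.blueMatrix, I.k.bits))
    (fun I => I.enc_eq) fun O hO I => ?_
  change Enc.bool _ = Enc.bool _
  congr 1
  rw [Bool.eq_iff_iff, EPMInstance.solveMatching_iff I hO]
  simp

/-! ### Reduction of minimal matchings to Exact Perfect Matching -/

/-- After the `L` lowest digits the accumulator is `⌊(m * (b mod 2^L) - 12 * (a mod 2^L)) / 2^L⌋ +
12`. The offset 12 avoids negative numbers and is reproduced by each step: a digit of `a` is entered
as `12 - 12 * digit`, and `(12 + 12) / 2 = 12`. At the end the floor is nonnegative exactly when `m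
* b - 12 * a` is. -/
theorem twelveLe_iff (m a b : ℕ) : twelveLe m a.bits b.bits = true ↔ 12 * a ≤ m * b := by
  have key : ∀ L : ℕ, (((List.range L).foldl (fun e i =>
      (e + ((bif b.bits.getD i false then m else 0) +
        (bif a.bits.getD i false then 0 else 12))) / 2) 12 : ℕ) : ℤ) =
      ((m : ℤ) * (b % 2 ^ L : ℕ) - 12 * (a % 2 ^ L : ℕ)) / 2 ^ L + 12 := by
    intro L
    induction L with
    | zero => simp [Nat.mod_one]
    | succ L ih =>
      have hpos : (2 : ℤ) ^ L ≠ 0 := by positivity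
      rw [List.range_succ, List.foldl_append, List.foldl_cons, List.foldl_nil, Nat.getD_bits,
        Nat.getD_bits, Nat.testBit_eq_decide_div_mod_eq, Nat.testBit_eq_decide_div_mod_eq,
        Nat.mod_pow_succ, Nat.mod_pow_succ]
      push_cast at ih ⊢
      rw [ih, pow_succ, ← Int.ediv_ediv_of_nonneg (by positivity)]
      have h1 : (m : ℤ) * ((b : ℤ) % 2 ^ L + 2 ^ L * ((b : ℤ) / 2 ^ L % 2)) -
          12 * ((a : ℤ) % 2 ^ L + 2 ^ L * ((a : ℤ) / 2 ^ L % 2)) =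
          ((m : ℤ) * ((b : ℤ) % 2 ^ L) - 12 * ((a : ℤ) % 2 ^ L)) +
          ((m : ℤ) * ((b : ℤ) / 2 ^ L % 2) - 12 * ((a : ℤ) / 2 ^ L % 2)) * 2 ^ L := by ring
      rw [h1, Int.add_mul_ediv_right _ _ hpos]
      have ha : (a / 2 ^ L % 2 = 0 ∨ a / 2 ^ L % 2 = 1) := by omega
      have hb : (b / 2 ^ L % 2 = 0 ∨ b / 2 ^ L % 2 = 1) := by omega
      have ha' : ((a : ℤ) / 2 ^ L % 2) = (a / 2 ^ L % 2 : ℕ) := by push_cast; rfl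
      have hb' : ((b : ℤ) / 2 ^ L % 2) = (b / 2 ^ L % 2 : ℕ) := by push_cast; rfl
      rw [ha', hb']
      rcases ha with ha | ha <;> rcases hb with hb | hb <;> simp [ha, hb] <;> omega
  -- The loop runs through more positions than either number has digits, so the residues are the
  -- numbers themselves.
  have hlt : ∀ c L : ℕ, c.bits.length ≤ L → c % 2 ^ L = c := fun c L h => by
    rw [Nat.size_eq_bits_len] at h
    exact Nat.mod_eq_of_lt ((Nat.lt_size_self c).trans_le (Nat.pow_le_pow_right two_pos h))
  have h := key (a.bits.length + b.bits.length)
  rw [hlt a _ (Nat.le_add_right _ _), hlt b _ (Nat.le_add_left _ _)] at h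
  rw [twelveLe, decide_eq_true_eq, ← Nat.cast_le (α := ℤ), h, Nat.cast_ofNat,
    le_add_iff_nonneg_left, Int.ediv_nonneg_iff_of_pos (by positivity), sub_nonneg]
  exact_mod_cast Iff.rfl

/-- The encoding of a rational number with its numbers in binary. -/
def ratBits (r : ℚ) : (Bool × List Bool) × List Bool :=
  ((decide (r.num < 0), r.num.natAbs.bits), r.den.bits)

/-- Clearing the positive denominator turns the comparison into one of natural numbers. A negative
numerator needs no computation because the right-hand side is nonnegative. -/
theorem isPreferred_iff (parts : List Bool) (r : ℚ) (b c : ℕ) :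
    isPreferred parts (ratBits r) b c = true ↔
      12 * r ≤ 6 * (countBool false parts : ℚ) + (b + c) := by
  have hden : (0 : ℚ) < r.den := by exact_mod_cast r.den_pos
  have hr : r * r.den = r.num := Rat.mul_den_eq_num r
  have hm : (6 * (countBool false parts : ℚ) + (b + c)) =
    ((6 * countBool false parts + (b + c) : ℕ) : ℚ) := by push_cast; ring
  rw [isPreferred, ratBits, Bool.or_eq_true, decide_eq_true_eq, twelveLe_iff, hm,
    ← mul_le_mul_iff_left₀ hden, mul_assoc, hr]
  generalize 6 * countBool false parts + (b + c) = m
  rcases lt_or_ge r.num 0 with h | h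
  · have h1 : (12 * (r.num : ℚ)) ≤ m * r.den := by
      have : (r.num : ℚ) < 0 := by exact_mod_cast h
      have : (0 : ℚ) ≤ m * r.den := by positivity
      linarith
    exact ⟨fun _ => h1, fun _ => .inl h⟩
  · have h1 : (r.num : ℚ) = (r.num.natAbs : ℕ) := by
      rw [← Int.cast_natCast, Int.natAbs_of_nonneg h]
    rw [h1, or_iff_right (not_lt.2 h)]
    exact_mod_cast Iff.rfl

/-- Folding an increasing list with a comparison that is correct for increasing pairs yields a
best element. -/
theorem List.foldl_best {τ : ℚ} {p : ℕ → ℕ → Bool} (hp : ∀ b c, p b c = true ↔ τ ≤ b + c)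
    (l : List ℕ) (b : ℕ) (hl : (b :: l).Pairwise (· ≤ ·)) :
    let r := l.foldl (fun b c => bif p b c then b else c) b
    r ∈ b :: l ∧ ∀ c ∈ b :: l, |τ - 2 * r| ≤ |τ - 2 * c| := by
  induction l generalizing b with
  | nil => simp
  | cons c l ih =>
    have hbc : b ≤ c := (List.pairwise_cons.1 hl).1 c (by simp)
    have hbc' : (b : ℚ) ≤ c := by exact_mod_cast hbc
    have hl' := (List.pairwise_cons.1 hl).2
    have hlb : (b :: l).Pairwise (· ≤ ·) :=
      hl.sublist (List.Sublist.cons_cons b (List.sublist_cons_self c l))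
    simp only [List.foldl_cons]
    cases h : p b c with
    | true =>
      have hτ := (hp b c).1 h
      obtain ⟨h1, h2⟩ := ih b hlb
      simp only [cond_true]
      refine ⟨by simp only [List.mem_cons] at h1 ⊢; tauto, fun d hd => ?_⟩
      -- The difference of the squares is `4 * (c - b) * (b + c - τ)`, so for `b ≤ c` the comparison
      -- depends only on the sign of `b + c - τ`.
      have h3 : |τ - 2 * b| ≤ |τ - 2 * c| := by
        rw [← sq_le_sq]
        nlinarith
      simp only [List.mem_cons] at hd
      rcases hd with rfl | rfl | hd
      · exact h2 _ (by simp)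
      · exact (h2 b (by simp)).trans h3
      · exact h2 _ (by simp [hd])
    | false =>
      have hτ : ¬ τ ≤ b + c := fun h' => by simp [(hp b c).2 h'] at h
      obtain ⟨h1, h2⟩ := ih c hl'
      simp only [cond_false]
      refine ⟨List.mem_cons_of_mem _ h1, fun d hd => ?_⟩
      have h3 : |τ - 2 * c| ≤ |τ - 2 * b| := by
        rw [← sq_le_sq]
        nlinarith
      rw [List.mem_cons] at hd
      rcases hd with rfl | hd
      · exact (h2 c (by simp)).trans h3
      · exact h2 _ hd

/-- Greedy deletion yields a minimal set with respect to a property that is preserved when fewer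
elements are deleted. -/
theorem List.foldl_greedy {α : Type} {A : List α → Prop} {t : List α → Bool}
    (ht : ∀ L, t L = true ↔ A L) (hA : ∀ L L', L ⊆ L' → A L' → A L) (ps L : List α) (hL : A L) :
    let L' := ps.foldl (fun L p => bif t (p :: L) then p :: L else L) L
    A L' ∧ L ⊆ L' ∧ ∀ p ∈ ps, p ∈ L' ∨ ¬ A (p :: L') := by
  induction ps generalizing L with
  | nil => simpa using hL
  | cons p ps ih =>
    simp only [List.foldl_cons]
    cases h : t (p :: L) with
    | true =>
      obtain ⟨h1, h2, h3⟩ := ih (p :: L) ((ht _).1 h)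
      simp only [cond_true]
      refine ⟨h1, fun x hx => h2 (List.mem_cons_of_mem _ hx), fun x hx => ?_⟩
      rw [List.mem_cons] at hx
      rcases hx with rfl | hx
      · exact .inl (h2 (by simp))
      · exact h3 x hx
    | false =>
      obtain ⟨h1, h2, h3⟩ := ih L hL
      simp only [cond_false]
      refine ⟨h1, h2, fun x hx => ?_⟩
      rw [List.mem_cons] at hx
      rcases hx with rfl | hx
      -- The element was rejected when fewer elements had been deleted, and further deletions cannot
      -- make it removable. One pass is therefore enough.
      · refine .inr fun hA' => ?_
        have := (ht _).2 (hA _ _ (List.cons_subset_cons _ h2) hA')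
        simp [this] at h
      · exact h3 x hx

theorem isKept_iff (L : List (ℕ × ℕ)) (i j : ℕ) :
    isKept L i j = true ↔ (i, j) ∉ L ∧ (j, i) ∉ L := by
  simp only [isKept, List.all_eq_true, Bool.not_eq_true', Bool.or_eq_false_iff,
    Bool.and_eq_false_iff, decide_eq_false_iff_not]
  constructor
  · intro h
    refine ⟨fun hm => ?_, fun hm => ?_⟩
    · simpa using (h _ hm).1
    · simpa using (h _ hm).2
  · rintro ⟨h1, h2⟩ ⟨k, l⟩ hm
    refine ⟨?_, ?_⟩ <;> by_contra hc <;> push Not at hc <;> obtain ⟨rfl, rfl⟩ := hc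
    · exact h1 hm
    · exact h2 hm

theorem Enc.toBool_nat (m : ℕ) : (Enc.nat m).toBool = true ↔ m ≠ 0 := by
  rcases eq_or_ne m 0 with rfl | h
  · simp [Enc.nat, Enc.list, DTree.toBool]
  · simp [Enc.nat, Nat.bits_of_ne_zero h, Enc.list, DTree.toBool, h]

/-! ### Games as instances of Exact Perfect Matching, and the extraction of a matching -/

namespace PerfectGameInstance

variable (I : PerfectGameInstance)

/-- The matrix of the encoded weights. -/
def weightMatrix : List (List DTree) :=
  List.ofFn fun i => List.ofFn fun j => Enc.rat (I.game.w i j)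

/-- The list of the parts. -/
def partList : List Bool := List.ofFn fun i => decide (I.game.part i = 1)

theorem enc_eq :
    I.enc = code (I.weightMatrix, I.partList, ratBits (I.x 0), ratBits (I.x 1)) := by
  have h1 := code_matrix fun i j => Enc.rat (I.game.w i j)
  have h2 := code_ofFn fun i => decide (I.game.part i = 1)
  change DTree.cons (Enc.matrix fun i j => code (Enc.rat (I.game.w i j)))
    (DTree.cons (Enc.vector fun i => code (decide (I.game.part i = 1))) _) = _
  rw [← h1, ← h2]
  rfl

theorem length_partList : I.partList.length = I.n := by simp [partList]

/-- Weights are positive on arcs and zero elsewhere, so an arc is recognised by a nonempty encoding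
of the numerator. -/
theorem gameEdge_iff (i j : Fin I.n) :
    gameEdge I.weightMatrix i j = true ↔ I.game.graph.Adj i j := by
  have h : ∀ i j : Fin I.n, (treeEntry I.weightMatrix i j).hd.tl.toBool = true ↔
      I.game.arcs.Adj i j := by
    intro i j
    rw [weightMatrix, treeEntry_ofFn]
    change (Enc.nat (I.game.w i j).num.natAbs).toBool = true ↔ _
    rw [Enc.toBool_nat, Int.natAbs_ne_zero, Rat.num_ne_zero]
    constructor
    · intro h
      by_contra hc
      exact h (I.game.w_zero i j hc)
    · exact fun h => (I.game.w_pos i j h).ne'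
  rw [gameEdge, Bool.and_eq_true, h, h]
  rfl

theorem getD_partList (i : Fin I.n) :
    I.partList.getD i false = decide (I.game.part i = 1) := List.getD_ofFn _ _ _

theorem countBool_partList : countBool false I.partList = I.game.size := by
  classical
  rw [countBool, partList, List.length_filter_ofFn, DirPMGame.size]
  congr 1
  ext i
  rcases I.game.part_eq i with h | h <;> simp [h]

/-- The instance of Exact Perfect Matching for the graph without the pairs in `L`, with the
crossing edges as red edges. -/
def toEPM (L : List (ℕ × ℕ)) (c : ℕ) : EPMInstance where
  n := I.n
  graph :=
    { Adj := fun i j => I.game.graph.Adj i j ∧ isKept L i j = true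
      symm := ⟨fun i j h => ⟨h.1.symm, by
        have := h.2
        rw [isKept_iff] at this ⊢
        exact this.symm⟩⟩
      loopless := ⟨fun i h => I.game.graph.loopless.irrefl i h.1⟩ }
  red := {e | e ∈ I.game.crossing} ∩ SimpleGraph.edgeSet _
  blue := {e | e ∉ I.game.crossing} ∩ SimpleGraph.edgeSet _
  union_eq := by
    rw [← Set.union_inter_distrib_right]
    ext e
    simp only [Set.mem_inter_iff, Set.mem_union, Set.mem_ofPred_eq]
    tauto
  disj := by
    rw [Set.disjoint_left]
    exact fun e h1 h2 => h2.1 h1.1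
  k := c

/-- The graph without the pairs in `L` has a perfect matching with `c` crossing edges. -/
def Achieves (L : List (ℕ × ℕ)) (c : ℕ) : Prop :=
  ∃ f : Fin I.n → Fin I.n, Function.Involutive f ∧
    (∀ i, I.game.graph.Adj i (f i) ∧ isKept L i (f i) = true) ∧
    (Finset.univ.filter fun i => I.game.part i ≠ I.game.part (f i)).card = 2 * c

theorem isYes_toEPM_iff (L : List (ℕ × ℕ)) (c : ℕ) :
    (I.toEPM L c).IsYes ↔ I.Achieves L c := by
  classical
  rw [EPMInstance.isYes_iff]
  refine exists_congr fun f => and_congr_right fun _ => and_congr_right fun hG => ?_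
  have h : ∀ i, s(i, f i) ∈ (I.toEPM L c).red ↔ I.game.part i ≠ I.game.part (f i) := fun i =>
    ⟨fun h => DirPMGame.mem_crossing.1 h.1, fun h => ⟨DirPMGame.mem_crossing.2 h, hG i⟩⟩
  simp only [h]
  exact iff_of_eq (congrArg (· = 2 * c) (by congr))

theorem keptMatrix_eq (L : List (ℕ × ℕ)) (b : Bool) :
    keptMatrix I.weightMatrix I.partList L b = List.ofFn fun i : Fin I.n => List.ofFn fun j =>
      (gameEdge I.weightMatrix i j && isKept L i j) &&
        (decide (I.game.part i = I.game.part j) == b) := by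
  rw [keptMatrix, length_partList]
  refine (List.ofFn_eq_map_range fun i => List.ofFn_eq_map_range fun j => ?_).symm
  rw [getD_partList, getD_partList]
  congr 2
  rcases I.game.part_eq i with hi | hi <;> rcases I.game.part_eq j with hj | hj <;> simp [hi, hj]

theorem toEPM_enc (L : List (ℕ × ℕ)) (c : ℕ) : (I.toEPM L c).enc =
    code (keptMatrix I.weightMatrix I.partList L false, keptMatrix I.weightMatrix I.partList L true,
      c.bits) := by
  classical
  have h1 : keptMatrix I.weightMatrix I.partList L false = List.ofFn fun i : Fin I.n =>
      List.ofFn fun j => decide (s(i, j) ∈ (I.toEPM L c).red) := by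
    rw [keptMatrix_eq]
    congr 1
    funext i
    congr 1
    funext j
    rw [Bool.eq_iff_iff, Bool.and_eq_true, Bool.and_eq_true, gameEdge_iff, decide_eq_true_iff]
    simp only [beq_false, Bool.not_eq_true', decide_eq_false_iff_not]
    exact ⟨fun h => ⟨DirPMGame.mem_crossing.2 h.2, h.1⟩,
      fun h => ⟨h.2, DirPMGame.mem_crossing.1 h.1⟩⟩
  have h2 : keptMatrix I.weightMatrix I.partList L true = List.ofFn fun i : Fin I.n =>
      List.ofFn fun j => decide (s(i, j) ∈ (I.toEPM L c).blue) := by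
    rw [keptMatrix_eq]
    congr 1
    funext i
    congr 1
    funext j
    rw [Bool.eq_iff_iff, Bool.and_eq_true, Bool.and_eq_true, gameEdge_iff, decide_eq_true_iff]
    simp only [beq_true, decide_eq_true_eq]
    exact ⟨fun h => ⟨fun h' => DirPMGame.mem_crossing.1 h' h.2, h.1⟩,
      fun h => ⟨h.2, not_not.1 fun h' => h.1 (DirPMGame.mem_crossing.2 h')⟩⟩
  rw [EPMInstance.enc_eq, h1, h2]
  congr

/-- The tree in the query encodes the genuine instance `toEPM`, so the oracle is bound to answer
with the truth value. -/
theorem achievable_iff {O : DTree → DTree} (hO : ExactPerfectMatching.SolvedBy O)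
    (L : List (ℕ × ℕ)) (c : ℕ) :
    achievable O I.weightMatrix I.partList L c = true ↔ I.Achieves L c := by
  have h : O (I.toEPM L c).enc = Enc.prop (I.toEPM L c).IsYes := hO (I.toEPM L c)
  rw [achievable, ← toEPM_enc, h, Enc.prop, DTree.toBool_bool, ← isYes_toEPM_iff]
  simp

theorem Achieves.mono {I : PerfectGameInstance} {L L' : List (ℕ × ℕ)} {c : ℕ} (hL : L ⊆ L')
    (h : I.Achieves L' c) : I.Achieves L c := by
  obtain ⟨f, hf, hG, hc⟩ := h
  refine ⟨f, hf, fun i => ⟨(hG i).1, ?_⟩, hc⟩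
  have := (hG i).2
  rw [isKept_iff] at this ⊢
  exact ⟨fun h => this.1 (hL h), fun h => this.2 (hL h)⟩

theorem cross_eq_card {M : I.game.graph.Subgraph} {f : Fin I.n → Fin I.n}
    (hf : ∀ i j, M.Adj i j ↔ f i = j) : I.game.cross M =
    (Finset.univ.filter fun i => I.game.part i ≠ I.game.part (f i)).card := by
  classical
  rw [DirPMGame.cross, SimpleGraph.Subgraph.sum_card_adj_of_involutive hf
    fun i j => I.game.part i ≠ I.game.part j]

/-- The numbers of crossing edges of perfect matchings are achieved. -/
theorem exists_achieves {M : I.game.graph.Subgraph} (hM : M.IsPerfectMatching) :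
    ∃ c, I.game.cross M = 2 * c ∧ c ≤ I.n ∧ I.Achieves [] c := by
  obtain ⟨f, hf, hfM⟩ := hM.exists_involutive
  have h1 := I.game.cross_eq M
  have h2 := I.cross_eq_card hfM
  have h3 := (Finset.univ.filter fun i => I.game.part i ≠ I.game.part (f i)).card_le_univ
  rw [Fintype.card_fin] at h3
  exact ⟨_, h1, by omega, f, hf, fun i => ⟨M.adj_sub ((hfM i _).2 rfl), by simp [isKept]⟩,
    h2.symm.trans h1⟩

theorem bestNumber_spec {O : DTree → DTree} (hO : ExactPerfectMatching.SolvedBy O) :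
    I.Achieves [] (bestNumber O I.weightMatrix I.partList (ratBits (I.x 0))) ∧
    ∀ c ≤ I.n, I.Achieves [] c →
      |12 * I.x 0 - 6 * I.game.size -
        2 * (bestNumber O I.weightMatrix I.partList (ratBits (I.x 0)) : ℕ)| ≤
      |12 * I.x 0 - 6 * I.game.size - 2 * c| := by
  have hmem : ∀ c, c ∈ achievableList O I.weightMatrix I.partList ↔
      c ≤ I.n ∧ I.Achieves [] c := by
    intro c
    rw [achievableList, List.mem_filter, List.mem_range, length_partList, I.achievable_iff hO,
      Nat.lt_succ_iff]
  have hsorted : (achievableList O I.weightMatrix I.partList).Pairwise (· ≤ ·) :=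
    ((List.pairwise_lt_range).imp le_of_lt).sublist List.filter_sublist
  obtain ⟨M, hM⟩ := I.perfect.2.2
  obtain ⟨c₀, -, hc₀⟩ := I.exists_achieves hM
  rw [← hmem] at hc₀
  rw [bestNumber]
  cases hl : achievableList O I.weightMatrix I.partList with
  | nil => simp [hl] at hc₀
  | cons b l =>
    rw [hl] at hsorted hmem
    -- The fold starts at the head and runs over the whole list, so the head occurs twice; this is
    -- why monotonicity is only required with `≤`.
    have h := List.foldl_best (τ := 12 * I.x 0 - 6 * I.game.size)
      (p := isPreferred I.partList (ratBits (I.x 0))) (fun b c => by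
        rw [isPreferred_iff, countBool_partList]
        constructor <;> intro <;> linarith) (b :: l) b
      (List.pairwise_cons.2 ⟨by
        intro c hc
        rw [List.mem_cons] at hc
        rcases hc with rfl | hc
        · exact le_rfl
        · exact (List.pairwise_cons.1 hsorted).1 c hc, hsorted⟩)
    obtain ⟨h1, h2⟩ := h
    refine ⟨((hmem _).1 ?_).2, fun c hc hc' => h2 c (List.mem_cons_of_mem _ ((hmem c).2 ⟨hc, hc'⟩))⟩
    rw [List.mem_cons] at h1
    rcases h1 with h1 | h1
    · exact List.mem_cons.2 (.inl h1)
    · exact h1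

theorem deletedPairs_spec {O : DTree → DTree} (hO : ExactPerfectMatching.SolvedBy O) {c : ℕ}
    (hc : I.Achieves [] c) :
    I.Achieves (deletedPairs O I.weightMatrix I.partList c) c ∧
    ∀ i j : Fin I.n, ((i : ℕ), (j : ℕ)) ∈ deletedPairs O I.weightMatrix I.partList c ∨
      ¬ I.Achieves (((i : ℕ), (j : ℕ)) :: deletedPairs O I.weightMatrix I.partList c) c := by
  obtain ⟨h1, -, h2⟩ := List.foldl_greedy (A := fun L => I.Achieves L c)
    (t := fun L => achievable O I.weightMatrix I.partList L c)
    (fun L => I.achievable_iff hO L c) (fun L L' hL h => h.mono hL)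
    ((List.range I.partList.length).flatMap fun i => (List.range I.partList.length).map
      fun j => (i, j)) [] hc
  refine ⟨h1, fun i j => h2 _ ?_⟩
  simp [length_partList]

/-- The matching `f` that survives the deletions consists of remaining edges. Any other remaining
edge could still be deleted with `f` as a witness, which the greedy procedure excludes. So the
remaining matrix is the adjacency matrix of a perfect matching with the best number of crossing
edges. -/
theorem solveGame_correct {O : DTree → DTree} (hO : ExactPerfectMatching.SolvedBy O) :
    ∃ M : I.game.graph.Subgraph, I.game.IsMinimalMatching I.x M ∧
      code (solveGame O I.weightMatrix I.partList (ratBits (I.x 0))) =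
        Enc.matrix fun i j => Enc.prop (M.Adj i j) := by
  classical
  obtain ⟨hc, hbest⟩ := I.bestNumber_spec hO
  obtain ⟨⟨f, hf, hG, hcard⟩, hdel⟩ := I.deletedPairs_spec hO hc
  rw [solveGame]
  set c := bestNumber O I.weightMatrix I.partList (ratBits (I.x 0))
  set L := deletedPairs O I.weightMatrix I.partList c
  obtain ⟨M, hM, hfM⟩ :=
    I.game.graph.exists_isPerfectMatching_of_involutive hf fun i => (hG i).1
  refine ⟨M, (I.perfect.isMinimalMatching_iff I.alloc).2 ⟨hM, fun M' hM' => ?_⟩, ?_⟩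
  · obtain ⟨c', h1, h2, h3⟩ := I.exists_achieves hM'
    have h4 := hbest c' h2 h3
    rw [I.cross_eq_card hfM, hcard, h1]
    push_cast
    exact h4
  · rw [← code_prop_matrix, remainingMatrix, length_partList]
    congr 1
    refine (List.ofFn_eq_map_range fun i => List.ofFn_eq_map_range fun j => ?_).symm
    rw [Bool.eq_iff_iff, decide_eq_true_iff, Bool.and_eq_true, gameEdge_iff, hfM]
    constructor
    · rintro rfl
      exact hG i
    · rintro ⟨-, hk⟩
      rw [isKept_iff] at hk
      by_contra hne
      -- The same `f` shows that `ij` is deletable: since `f i ≠ j`, it uses the pair in neither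
      -- orientation.
      refine ((hdel i j).resolve_left hk.1) ⟨f, hf, fun k => ⟨(hG k).1, ?_⟩, hcard⟩
      have := (hG k).2
      rw [isKept_iff] at this ⊢
      simp only [List.mem_cons, Prod.mk.injEq, Fin.val_inj, not_or]
      refine ⟨⟨?_, this.1⟩, ?_, this.2⟩
      · rintro ⟨rfl, h⟩
        exact hne h
      · rintro ⟨h, rfl⟩
        exact hne (by rw [← h, hf])

end PerfectGameInstance

theorem minimalMatchingPerfectGame_polyReducible :
    PolyReducible MinimalMatchingPerfectGame ExactPerfectMatching :=
  PolyTime.solveGame.polyReducible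
    (fun I => (I.weightMatrix, I.partList, ratBits (I.x 0), ratBits (I.x 1)))
    (fun I => I.enc_eq) fun _ hO I => I.solveGame_correct hO

theorem theorem9 : PolyEquivalent ExactPerfectMatching MinimalMatchingPerfectGame := by
  exact ⟨exactPerfectMatching_polyReducible, minimalMatchingPerfectGame_polyReducible⟩
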